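/- Let $\Sigma=\mathbb{P}^1\setminus\{0,1,\infty\}$, let $\widetilde\Sigma\to\Sigma$ be its universal cover and $\Gamma$ the group of deck transformations. Let $w_1,w_2,w_3\in(-\infty,1)\setminus\{0\}$, let $n_j=\tfrac12\bigl(1-\sqrt{1-w_j}\bigr)$, and put $$\xi_W=\begin{pmatrix}0&\lambda^{-1}\,dz\\ (\lambda-1)^2\,Q_W/dz&0\end{pmatrix},\qquad Q_W=\frac{w_3z^2-(w_1-w_2+w_3)z+w_1}{16\,z^2(z-1)^2}\,dz^2 .$$ Let $r\in(0,1]$, and let $\Phi(z,\lambda)$, $z\in\widetilde\Sigma$, $\lambda\in\mathbb{C}\setminus\{0\}$, be a $2\times2$ matrix valued solution of $d\Phi=\Phi\,\xi_W$ on $\widetilde\Sigma$ which is invertible for $|\lambda|=r$ and for which $\Phi(p,\cdot)$ is holomorphic on $\mathbb{C}\setminus\{0\}$ for some $p\in\widetilde\Sigma$. Let $M_\Phi(\tau)=(\tau^*\Phi)\Phi^{-1}$, $\tau\in\Gamma$, be its monodromy representation. (It does not depend on $z$, and is defined for all $\lambda\neq0$ at which $\Phi$ is invertible, hence at all but finitely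 many $\lambda\in\mathbb{S}^1$.) Consider the neck and weight inequalities $$|n_1|+|n_2|+|n_3|\le 1,\qquad |n_i|\le|n_j|+|n_k|,\qquad |w_i|\le|w_j|+|w_k|\qquad(\{i,j,k\}=\{1,2,3\}).$$ (i) If these inequalities hold, then for all but finitely many $\lambda\in\mathbb{S}^1=\{|\lambda|=1\}$ the monodromy representation at $\lambda$ is nondegenerate (there are $\sigma,\tau\in\Gamma$ such that $M_\Phi(\sigma)$ and $M_\Phi(\tau)$ do not commute) and simultaneously unitarizable (there is $C\in\mathrm{GL}_2(\mathbb{C})$, depending on $\lambda$, with $C\,M_\Phi(\tau)\,C^{-1}\in\mathrm{U}_2$ for all $\tau\in\Gamma$). (ii) Conversely, if for all but finitely many $\lambda\in\mathbb{S}^1$ the monodromy representation at $\lambda$ is nondegenerate and simultaneously unitarizable, then the neck and weight inequalities hold. -/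

import Mathlib

open Matrix

noncomputable section

namespace Trinoid

/-- The thrice-punctured sphere `ℙ¹ ∖ {0, 1, ∞}`, in its standard coordinate `z`. -/
abbrev Base : Type := {z : ℂ // z ≠ 0 ∧ z ≠ 1}

/-- A universal covering of the thrice-punctured sphere: a covering map whose total space is
simply connected.  The total space carries the complex structure pulled back by `p`. -/
structure IsUniversalCover {X : Type*} [TopologicalSpace X] (p : X → Base) : Prop where
  simplyConnected : SimplyConnectedSpace X
  isCoveringMap : IsCoveringMap p

/-- The group of deck transformations of `p`, as a set of self-homeomorphisms. -/
def deck {X : Type*} [TopologicalSpace X] (p : X → Base) : Set (X ≃ₜ X) :=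
  {τ | ∀ x, p (τ x) = p x}

/-- The necksize `n = (1 - √(1 - w)) / 2` of weight `w`. -/
def neck (w : ℝ) : ℝ := (1 - Real.sqrt (1 - w)) / 2

/-- The neck inequalities.  The entries of `W : Fin 3 → ℝ` are the weights
`w₁ = W 0`, `w₂ = W 1`, `w₃ = W 2` at the punctures `0`, `1`, `∞`. -/
def NeckInequalities (W : Fin 3 → ℝ) : Prop :=
  |neck (W 0)| + |neck (W 1)| + |neck (W 2)| ≤ 1 ∧
    ∀ i j k : Fin 3, i ≠ j → j ≠ k → i ≠ k → |neck (W i)| ≤ |neck (W j)| + |neck (W k)|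

/-- The weight inequalities. -/
def WeightInequalities (W : Fin 3 → ℝ) : Prop :=
  ∀ i j k : Fin 3, i ≠ j → j ≠ k → i ≠ k → |W i| ≤ |W j| + |W k|

/-- The coefficient of `dz²` in the quadratic differential `Q_W`. -/
def quadDiff (W : Fin 3 → ℝ) (z : ℂ) : ℂ :=
  ((W 2 : ℂ) * z ^ 2 - ((W 0 : ℂ) - (W 1 : ℂ) + (W 2 : ℂ)) * z + (W 0 : ℂ)) /
    (16 * z ^ 2 * (z - 1) ^ 2)

/-- The coefficient of `dz` in the potential `ξ_W`, at the loop parameter `l`. -/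
def potential (W : Fin 3 → ℝ) (z l : ℂ) : Matrix (Fin 2) (Fin 2) ℂ :=
  !![0, l⁻¹; (l - 1) ^ 2 * quadDiff W z, 0]

/-- `Φ` solves `dΦ = Φ ξ_W` on the total space of `p`, for each `l ∈ ℂ ∖ {0}`.  Around each point
`p` restricts to a chart `e` of the total space, and in the coordinate `z = p x` the equation is
`∂Φ/∂z = Φ ξ_W`, entry by entry. -/
def SolvesODE {X : Type*} [TopologicalSpace X] (p : X → Base) (W : Fin 3 → ℝ)
    (Φ : X → ℂ → Matrix (Fin 2) (Fin 2) ℂ) : Prop :=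
  ∀ l : ℂ, l ≠ 0 → ∀ x : X, ∃ e : OpenPartialHomeomorph X ℂ,
    x ∈ e.source ∧ (∀ y ∈ e.source, e y = (p y : ℂ)) ∧
      ∀ i j : Fin 2, HasDerivAt (fun z : ℂ => Φ (e.symm z) l i j)
        ((Φ x l * potential W (p x : ℂ) l) i j) (p x : ℂ)

/-- The monodromy `M_Φ(τ) = (τ^* Φ) Φ⁻¹` at the loop parameter `l`, evaluated at `x`. -/
def monodromy {X : Type*} [TopologicalSpace X] (Φ : X → ℂ → Matrix (Fin 2) (Fin 2) ℂ)
    (x : X) (l : ℂ) (τ : X ≃ₜ X) : Matrix (Fin 2) (Fin 2) ℂ :=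
  Φ (τ x) l * (Φ x l)⁻¹

/-- A set of matrices is nondegenerate if two of its members do not commute. -/
def Nondegenerate (S : Set (Matrix (Fin 2) (Fin 2) ℂ)) : Prop :=
  ∃ A ∈ S, ∃ B ∈ S, A * B ≠ B * A

/-- A set of matrices is simultaneously unitarizable if a single element of `GL₂(ℂ)` conjugates
all of its members into `U₂`. -/
def SimultaneouslyUnitarizable (S : Set (Matrix (Fin 2) (Fin 2) ℂ)) : Prop :=
  ∃ C : GL (Fin 2) ℂ, ∀ M ∈ S,
    (C : Matrix (Fin 2) (Fin 2) ℂ) * M * ((C⁻¹ : GL (Fin 2) ℂ) : Matrix (Fin 2) (Fin 2) ℂ) ∈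
      Matrix.unitaryGroup (Fin 2) ℂ

/-- The image of the monodromy representation of `Φ` is nondegenerate and simultaneously
unitarizable at every point of the unit circle outside a finite set. -/
def PointwiseUnitarizable {X : Type*} [TopologicalSpace X] (p : X → Base)
    (Φ : X → ℂ → Matrix (Fin 2) (Fin 2) ℂ) (x : X) : Prop :=
  ∃ E : Set ℂ, E.Finite ∧ ∀ l : ℂ, ‖l‖ = 1 → l ∉ E →
    Nondegenerate (monodromy Φ x l '' deck p) ∧
      SimultaneouslyUnitarizable (monodromy Φ x l '' deck p)

end Trinoid

end

/-!
The equation `dΦ = Φ ξ_W` amounts, for the second entry `b` of each row, to the scalar equation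
`b'' = ((l - 1)² / l) q b` with `q` the coefficient of `Q_W`. On the unit circle
`(l - 1)² / l = -4 t` with `t = (1 - Re l) / 2 ∈ [0, 1]`, and the exponents at the puncture of
weight `w` are `ν = neck (t w)` and `1 - ν`. So the local monodromies are unimodular with traces
`2 cos (2π neck (t w_k))`, real and at most `2` in absolute value.

*Traces.* Near a puncture the gauge `gauge` turns the equation into one in `log (z - c)` whose
coefficient matrix converges at the puncture. By Grönwall's inequality
(`tendsto_exp_of_hasDerivAt`) the transport along a small circle, or a large one for `∞`, converges
to the exponential of the limit, up to conjugation. As the trace of the monodromy does not depend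
on the circle, it is the trace of that exponential (`trace_loop_eq`,
`trace_exp_gaugedPotential`). No power series and no discussion of resonances are needed.

*Generators.* Two slit planes, slit downwards and upwards, carry sections of the universal cover
which agree over `(0, 1)`. Comparing them over `(-∞, 0)` and `(1, ∞)` gives two monodromy matrices
`A` and `B`; the loops around `0`, `1`, `∞` have monodromies `A⁻¹`, `B` and `A⁻¹ B` up to
conjugation and orientation. The coset of a branch modulo the group generated by `A` and `B` is
locally constant on the total space, so `A` and `B` generate the monodromy group
(`IsFlat.monodromy_mem_closure`), without recourse to the van Kampen theorem.

*Unitarizability.* For unimodular `A`, `B` one has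
`det (AB - BA) = 4 (1 - x² - y² - z² + 2xyz)` in terms of the half traces `x`, `y`, `z` of `A`, `B`,
`AB`. For noncommuting elements of `SU₂` the commutator is a nonzero quaternion, so this is
positive (`discr_pos_of_mem_unitaryGroup`); conversely, if it is positive, diagonalizing `A` and
rescaling an eigenvector makes both matrices unitary (`exists_unitarizer`). Hence the monodromy at
`l` is nondegenerate and unitarizable if and only if the discriminant `spectralDiscr W t` is
positive (`SolvesODE.unitarizable_iff`).

*Inequalities.* Put `n_k = |neck (t w_k)|`. The discriminant equals
`4 sin πS sin πD₁ sin πD₂ sin πD₃` with `S = n₁ + n₂ + n₃` and `D_i = S - 2 n_i`. The neck and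
weight inequalities make all four arguments lie strictly between `0` and `π` for `0 < t < 1`: if `w_i < 0`,
then `D_i > 0` follows from the weight inequality (`abs_neck_lt_of_neg`), and if `w_i > 0`, from
the neck inequality at `t = 1` (`abs_neck_lt_of_pos`); the sum `S` increases with `t`. Conversely
the discriminant, being positive off a finite set, is nonnegative on `[0, 1]`. Its behaviour at
`t → 0` forces the weight inequalities, and a failing neck inequality would make exactly one
of the four sines negative for some `t`.
-/

noncomputable section

namespace Trinoid

open Filter Topology

/-! ### Necksizes along the spectral segment -/

lemma four_mul_neck_mul {w : ℝ} (hw : w ≤ 1) : 4 * neck w * (1 - neck w) = w := by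
  have h := Real.sq_sqrt (sub_nonneg.2 hw)
  unfold neck
  linear_combination (-1) * h

lemma neck_lt_half {w : ℝ} (hw : w < 1) : neck w < 1 / 2 := by
  have h := Real.sqrt_pos.2 (sub_pos.2 hw)
  unfold neck
  linarith

lemma neck_zero : neck 0 = 0 := by simp [neck]

lemma neck_mono {v w : ℝ} (h : v ≤ w) : neck v ≤ neck w := by
  have := Real.sqrt_le_sqrt (sub_le_sub_left h 1)
  unfold neck
  linarith

lemma neck_strictMono {v w : ℝ} (h : v < w) (hv : v < 1) : neck v < neck w := by
  have := Real.sqrt_lt_sqrt_iff_of_pos (x := 1 - w) (sub_pos.2 hv)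
  have := this.2 (by linarith)
  unfold neck
  linarith

lemma neck_pos {w : ℝ} (h : 0 < w) : 0 < neck w := by
  simpa [neck_zero] using neck_strictMono h one_pos

lemma neck_neg {w : ℝ} (h : w < 0) : neck w < 0 := by
  simpa [neck_zero] using neck_strictMono h (by linarith)

lemma neck_nonneg {w : ℝ} (h : 0 ≤ w) : 0 ≤ neck w := by
  simpa [neck_zero] using neck_mono h

lemma mul_lt_one_of_mem {t w : ℝ} (ht : 0 ≤ t) (ht' : t ≤ 1) (hw : w < 1) : t * w < 1 := by
  rcases le_or_gt w 0 with h | h <;> nlinarith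

lemma abs_neck_pos {w : ℝ} (h : w ≠ 0) : 0 < |neck w| :=
  abs_pos.2 <| by
    rcases h.lt_or_gt with h | h
    exacts [(neck_neg h).ne, (neck_pos h).ne']

lemma abs_neck_mul_strictMono {w s t : ℝ} (hw : w < 1) (hw0 : w ≠ 0) (hs : 0 ≤ s) (hst : s < t)
    (ht : t ≤ 1) : |neck (s * w)| < |neck (t * w)| := by
  have hs1 := mul_lt_one_of_mem hs (hst.le.trans ht) hw
  have ht1 := mul_lt_one_of_mem (hs.trans hst.le) ht hw
  rcases hw0.lt_or_gt with h | h
  · have h1 : t * w < s * w := by nlinarith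
    have h2 : s * w ≤ 0 := by nlinarith
    have h3 := neck_strictMono h1 ht1
    have h4 : neck (s * w) ≤ 0 := by simpa [neck_zero] using neck_mono h2
    rw [abs_of_nonpos h4, abs_of_neg (h3.trans_le h4)]
    linarith
  · have h1 : s * w < t * w := by nlinarith
    have h2 : 0 ≤ s * w := by positivity
    have h3 := neck_strictMono h1 hs1
    have h4 := neck_nonneg h2
    rw [abs_of_nonneg h4, abs_of_pos (h4.trans_lt h3)]
    exact h3

/-- For `t < 1`, the passage from the necksize `x` of a positive weight to the necksize of `t`
times that weight is strictly subadditive. -/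
lemma neck_scaled_add_lt {t x y : ℝ} (ht : 0 < t) (ht1 : t < 1) (hx : 0 < x) (hy : 0 < y)
    (hxy : x + y < 1 / 2) :
    neck (t * (4 * (x + y) * (1 - (x + y)))) <
      neck (t * (4 * x * (1 - x))) + neck (t * (4 * y * (1 - y))) := by
  have key : ∀ z : ℝ, 0 < z → z < 1 / 2 → ∃ u, neck (t * (4 * z * (1 - z))) = u ∧ 0 < u ∧
      u < 1 / 2 ∧ u * (1 - u) = t * (z * (1 - z)) ∧ u < t * z := by
    intro z hz hz2
    have hw1 : 4 * z * (1 - z) < 1 := by nlinarith [sq_pos_of_pos (sub_pos.2 hz2)]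
    have hw0 : 0 < 4 * z * (1 - z) := by
      have : 0 < 1 - z := by linarith
      positivity
    have htw : t * (4 * z * (1 - z)) < 1 := mul_lt_one_of_mem ht.le ht1.le hw1
    have h1 := four_mul_neck_mul htw.le
    have h2 := neck_lt_half htw
    have h3 := neck_pos (mul_pos ht hw0)
    set u := neck (t * (4 * z * (1 - z)))
    have h4 : u * (1 - u) = t * (z * (1 - z)) := by linarith
    have huz : u < z := by
      by_contra hcon
      push Not at hcon
      have : z * (1 - z) ≤ u * (1 - u) := by nlinarith
      nlinarith
    refine ⟨u, rfl, h3, h2, h4, ?_⟩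
    have : u * (1 - z) < t * z * (1 - z) := by nlinarith
    exact lt_of_mul_lt_mul_right this (by linarith)
  obtain ⟨u, hu, hu0, -, hu2, hu3⟩ := key x hx (by linarith)
  obtain ⟨v, hv, hv0, -, hv2, hv3⟩ := key y hy (by linarith)
  obtain ⟨m, hm, hm0, hm1, hm2, -⟩ := key (x + y) (by linarith) hxy
  rw [hu, hv, hm]
  by_contra hcon
  push Not at hcon
  have h1 : (u + v) * (1 - (u + v)) ≤ m * (1 - m) := by nlinarith
  have h2 : u * v < t * x * y := by
    calc u * v < t * x * v := by gcongr
      _ ≤ t * x * (t * y) := by gcongr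
      _ ≤ t * x * (1 * y) := by gcongr
      _ = t * x * y := by ring
  nlinarith

lemma neck_scaled_le_abs_neck {t w n : ℝ} (ht : 0 < t) (ht1 : t < 1) (hw : w < 1) (hw0 : w ≠ 0)
    (hn : 0 ≤ n) (hnw : n ≤ |neck w|) (hn2 : n < 1 / 2) :
    neck (t * (4 * n * (1 - n))) ≤ |neck (t * w)| := by
  rcases hw0.lt_or_gt with h | h
  · rw [abs_of_neg (neck_neg h)] at hnw
    have htw : t * w < 0 := by nlinarith
    rw [abs_of_neg (neck_neg htw)]
    have h1 := four_mul_neck_mul hw.le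
    have h2 := four_mul_neck_mul (w := t * w) (by linarith)
    have h3 := neck_neg h
    have h4 := neck_neg htw
    have hlt : t * (4 * n * (1 - n)) < 1 := mul_lt_one_of_mem ht.le ht1.le (by nlinarith)
    have h5 := four_mul_neck_mul hlt.le
    have h6 := neck_lt_half hlt
    have h7 : 0 ≤ neck (t * (4 * n * (1 - n))) := neck_nonneg (by
      have : 0 ≤ 1 - n := by linarith
      positivity)
    set u := neck (t * (4 * n * (1 - n)))
    set m := -neck (t * w) with hm
    set N := -neck w with hN
    have e1 : neck w = -N := by simp [hN]
    have e2 : neck (t * w) = -m := by simp [hm]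
    rw [e1] at h1
    rw [e2] at h2
    -- both sides are compared with `t * n`
    have hmN : m ≤ N := by
      by_contra hc
      push Not at hc
      nlinarith
    have h8 : t * N ≤ m := by
      have : t * N * (1 + N) ≤ m * (1 + N) := by nlinarith
      exact le_of_mul_le_mul_right this (by linarith)
    have hun : u ≤ n := by
      by_contra hc
      push Not at hc
      have h10 : n * (1 - n) < u * (1 - u) := by nlinarith
      have h11 : t * (n * (1 - n)) ≤ n * (1 - n) :=
        mul_le_of_le_one_left (mul_nonneg hn (by linarith)) ht1.le
      linarith
    have h9 : u ≤ t * n := by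
      have : u * (1 - n) ≤ t * n * (1 - n) := by nlinarith
      exact le_of_mul_le_mul_right this (by linarith)
    nlinarith
  · rw [abs_of_pos (neck_pos h)] at hnw
    rw [abs_of_pos (neck_pos (by positivity))]
    apply neck_mono
    have h1 := four_mul_neck_mul hw.le
    have h2 := neck_lt_half hw
    have : 4 * n * (1 - n) ≤ w := by nlinarith
    gcongr

/-- If the weight `u` is positive, the neck inequality at `t = 1` propagates to all `t < 1`. -/
lemma abs_neck_lt_of_pos {u v w t : ℝ} (hu : 0 < u) (hu1 : u < 1) (hv : v < 1) (hv0 : v ≠ 0)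
    (hw : w < 1) (hw0 : w ≠ 0) (h : |neck u| ≤ |neck v| + |neck w|) (ht : 0 < t) (ht1 : t < 1) :
    |neck (t * u)| < |neck (t * v)| + |neck (t * w)| := by
  have hn := neck_pos hu
  have hn2 := neck_lt_half hu1
  have h4 := four_mul_neck_mul hu1.le
  rw [abs_of_pos hn] at h
  rw [abs_of_pos (neck_pos (by positivity)), ← h4]
  have hv' := abs_neck_pos (w := t * v) (by positivity)
  have hw' := abs_neck_pos (w := t * w) (by positivity)
  rcases le_or_gt (neck u) |neck v| with h1 | h1
  · have := neck_scaled_le_abs_neck ht ht1 hv hv0 hn.le h1 hn2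
    linarith
  · have h2 := neck_scaled_le_abs_neck ht ht1 hv hv0 (abs_nonneg _) le_rfl (h1.trans hn2)
    have hv2 := abs_neck_pos hv0
    have h3 := neck_scaled_le_abs_neck (n := neck u - |neck v|) ht ht1 hw hw0 (by linarith)
      (by linarith) (by linarith)
    have h5 := neck_scaled_add_lt ht ht1 hv2 (sub_pos.2 h1) (by linarith)
    rw [add_sub_cancel] at h5
    linarith

lemma neg_neck_neg_abs_le (w : ℝ) (hw : w < 1) : -neck (-|w|) ≤ |neck w| := by
  rcases le_or_gt w 0 with h | h
  · rw [abs_of_nonpos h, neg_neg]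
    exact neg_le_abs _
  · rw [abs_of_pos h, abs_of_pos (neck_pos h)]
    have h1 := Real.sq_sqrt (sub_nonneg.2 hw.le)
    have h2 := Real.sq_sqrt (show 0 ≤ 1 - -w by linarith)
    have h3 := Real.sqrt_nonneg (1 - w)
    have h4 := Real.sqrt_nonneg (1 - -w)
    unfold neck
    nlinarith [sq_nonneg (√(1 - w) - √(1 - -w))]

/-- If the weight `u` is negative, the weight inequality gives the neck inequality for all `t`. -/
lemma abs_neck_lt_of_neg {u v w t : ℝ} (hu : u < 0) (hv : v < 1) (hv0 : v ≠ 0)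
    (hw : w < 1) (hw0 : w ≠ 0) (h : |u| ≤ |v| + |w|) (ht : 0 < t) (ht1 : t ≤ 1) :
    |neck (t * u)| < |neck (t * v)| + |neck (t * w)| := by
  have h1 := neg_neck_neg_abs_le (t * v) (mul_lt_one_of_mem ht.le ht1 hv)
  have h2 := neg_neck_neg_abs_le (t * w) (mul_lt_one_of_mem ht.le ht1 hw)
  rw [abs_mul, abs_of_pos ht] at h1 h2
  have h3 : neck (-(t * |v| + t * |w|)) ≤ neck (t * u) := by
    apply neck_mono
    rw [abs_of_neg hu] at h
    nlinarith
  rw [abs_of_neg (neck_neg (by nlinarith))]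
  have hb : 0 < t * |v| := by positivity
  have hc : 0 < t * |w| := by positivity
  set b := t * |v|
  set c := t * |w|
  have h4 : -neck (-(b + c)) < -neck (-b) + -neck (-c) := by
    have e1 := Real.sq_sqrt (show 0 ≤ 1 - -b by linarith)
    have e2 := Real.sq_sqrt (show 0 ≤ 1 - -c by linarith)
    have e3 := Real.sq_sqrt (show 0 ≤ 1 - -(b + c) by linarith)
    have f1 := (Real.lt_sqrt zero_le_one).2 (show 1 ^ 2 < 1 - -b by linarith)
    have f2 := (Real.lt_sqrt zero_le_one).2 (show 1 ^ 2 < 1 - -c by linarith)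
    have f3 := Real.sqrt_nonneg (1 - -(b + c))
    unfold neck
    set x := √(1 - -b)
    set y := √(1 - -c)
    set z := √(1 - -(b + c))
    have : z < x + y - 1 := by
      by_contra hcon
      push Not at hcon
      nlinarith [mul_pos (sub_pos.2 f1) (sub_pos.2 f2)]
    linarith
  linarith

/-! ### The discriminant of a triple of angles -/

/-- The discriminant of three half traces `cos a`, `cos b`, `cos c`: it is the Gram determinant of
three unit vectors with these mutual inner products. -/
def discr (a b c : ℝ) : ℝ :=
  1 - Real.cos a ^ 2 - Real.cos b ^ 2 - Real.cos c ^ 2 + 2 * Real.cos a * Real.cos b * Real.cos c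

lemma discr_abs (a b c : ℝ) : discr |a| |b| |c| = discr a b c := by
  simp [discr]

lemma discr_two_pi_mul (x y z : ℝ) :
    discr (2 * Real.pi * x) (2 * Real.pi * y) (2 * Real.pi * z) =
      4 * Real.sin (Real.pi * (x + y + z)) * Real.sin (Real.pi * (y + z - x)) *
        Real.sin (Real.pi * (x + z - y)) * Real.sin (Real.pi * (x + y - z)) := by
  have h1 := Real.cos_sub_cos (2 * Real.pi * z) (2 * Real.pi * x + 2 * Real.pi * y)
  have h2 := Real.cos_sub_cos (2 * Real.pi * x - 2 * Real.pi * y) (2 * Real.pi * z)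
  rw [Real.cos_add] at h1
  rw [Real.cos_sub] at h2
  rw [show (2 * Real.pi * z + (2 * Real.pi * x + 2 * Real.pi * y)) / 2 = Real.pi * (x + y + z) by
    ring, show (2 * Real.pi * z - (2 * Real.pi * x + 2 * Real.pi * y)) / 2 =
      -(Real.pi * (x + y - z)) by ring, Real.sin_neg] at h1
  rw [show (2 * Real.pi * x - 2 * Real.pi * y + 2 * Real.pi * z) / 2 = Real.pi * (x + z - y) by
    ring, show (2 * Real.pi * x - 2 * Real.pi * y - 2 * Real.pi * z) / 2 =
      -(Real.pi * (y + z - x)) by ring, Real.sin_neg] at h2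
  have h3 := Real.sin_sq_add_cos_sq (2 * Real.pi * x)
  have h4 := Real.sin_sq_add_cos_sq (2 * Real.pi * y)
  have h5 : discr (2 * Real.pi * x) (2 * Real.pi * y) (2 * Real.pi * z) =
      (Real.cos (2 * Real.pi * z) - (Real.cos (2 * Real.pi * x) * Real.cos (2 * Real.pi * y) -
        Real.sin (2 * Real.pi * x) * Real.sin (2 * Real.pi * y))) *
      (Real.cos (2 * Real.pi * x) * Real.cos (2 * Real.pi * y) +
        Real.sin (2 * Real.pi * x) * Real.sin (2 * Real.pi * y) - Real.cos (2 * Real.pi * z)) := by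
    unfold discr
    linear_combination (-Real.sin (2 * Real.pi * y) ^ 2) * h3 +
      (Real.cos (2 * Real.pi * x) ^ 2 - 1) * h4
  rw [h5, h1, h2]
  ring

lemma sin_pi_mul_pos {x : ℝ} (h0 : 0 < x) (h1 : x < 1) : 0 < Real.sin (Real.pi * x) :=
  Real.sin_pos_of_pos_of_lt_pi (by positivity) (by nlinarith [Real.pi_pos])

lemma sin_pi_mul_neg {x : ℝ} (h0 : x < 0) (h1 : -1 < x) : Real.sin (Real.pi * x) < 0 :=
  Real.sin_neg_of_neg_of_neg_pi_lt (by nlinarith [Real.pi_pos]) (by nlinarith [Real.pi_pos])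

lemma sin_pi_mul_neg' {x : ℝ} (h0 : 1 < x) (h1 : x < 2) : Real.sin (Real.pi * x) < 0 := by
  have := sin_pi_mul_pos (x := x - 1) (by linarith) (by linarith)
  rw [mul_sub, mul_one, Real.sin_sub_pi] at this
  linarith

/-- The discriminant of the local exponents of the spectral parameter `t`. -/
def spectralDiscr (W : Fin 3 → ℝ) (t : ℝ) : ℝ :=
  discr (2 * Real.pi * neck (t * W 0)) (2 * Real.pi * neck (t * W 1)) (2 * Real.pi * neck (t * W 2))

lemma discr_two_pi_mul_abs (x y z : ℝ) :
    discr (2 * Real.pi * |x|) (2 * Real.pi * |y|) (2 * Real.pi * |z|) =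
      discr (2 * Real.pi * x) (2 * Real.pi * y) (2 * Real.pi * z) := by
  have h : ∀ x : ℝ, 2 * Real.pi * |x| = |2 * Real.pi * x| := fun x => by
    rw [abs_mul, abs_of_pos (a := 2 * Real.pi) (by positivity)]
  rw [h, h, h, discr_abs]

/-- The spectral discriminant as a product, with the entries in any order. -/
lemma spectralDiscr_eq (W : Fin 3 → ℝ) (t : ℝ) {i j k : Fin 3} (hij : i ≠ j) (hjk : j ≠ k)
    (hik : i ≠ k) : spectralDiscr W t =
      4 * Real.sin (Real.pi * (|neck (t * W i)| + |neck (t * W j)| + |neck (t * W k)|)) *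
        Real.sin (Real.pi * (|neck (t * W j)| + |neck (t * W k)| - |neck (t * W i)|)) *
        Real.sin (Real.pi * (|neck (t * W i)| + |neck (t * W k)| - |neck (t * W j)|)) *
        Real.sin (Real.pi * (|neck (t * W i)| + |neck (t * W j)| - |neck (t * W k)|)) := by
  rw [← discr_two_pi_mul, discr_two_pi_mul_abs]
  fin_cases i <;> fin_cases j <;> fin_cases k <;> simp_all [spectralDiscr] <;>
    simp only [discr] <;> ring

lemma continuous_neck : Continuous neck := by unfold neck; fun_prop

lemma continuous_spectralDiscr (W : Fin 3 → ℝ) : Continuous (spectralDiscr W) := by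
  have := continuous_neck
  unfold spectralDiscr discr
  fun_prop

section Inequalities

variable {W : Fin 3 → ℝ}

lemma spectralDiscr_pos (hW : ∀ k, W k < 1 ∧ W k ≠ 0) (hN : NeckInequalities W)
    (hwt : WeightInequalities W) {t : ℝ} (ht : 0 < t) (ht1 : t < 1) : 0 < spectralDiscr W t := by
  have key : ∀ i j k : Fin 3, i ≠ j → j ≠ k → i ≠ k →
      |neck (t * W i)| < |neck (t * W j)| + |neck (t * W k)| := by
    intro i j k hij hjk hik
    rcases (hW i).2.lt_or_gt with h | h
    · exact abs_neck_lt_of_neg h (hW j).1 (hW j).2 (hW k).1 (hW k).2 (hwt i j k hij hjk hik) ht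
        ht1.le
    · exact abs_neck_lt_of_pos h (hW i).1 (hW j).1 (hW j).2 (hW k).1 (hW k).2
        (hN.2 i j k hij hjk hik) ht ht1
  have hS : |neck (t * W 0)| + |neck (t * W 1)| + |neck (t * W 2)| < 1 := by
    have h : ∀ k, |neck (t * W k)| < |neck (W k)| := fun k => by
      simpa using abs_neck_mul_strictMono (hW k).1 (hW k).2 ht.le ht1 le_rfl
    linarith [h 0, h 1, h 2, hN.1]
  have hpos : ∀ k, 0 < |neck (t * W k)| := fun k =>
    abs_neck_pos (mul_ne_zero ht.ne' (hW k).2)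
  have h0 := hpos 0
  have h1 := hpos 1
  have h2 := hpos 2
  have k0 := key 0 1 2 (by decide) (by decide) (by decide)
  have k1 := key 1 0 2 (by decide) (by decide) (by decide)
  have k2 := key 2 0 1 (by decide) (by decide) (by decide)
  rw [spectralDiscr_eq W t (i := 0) (j := 1) (k := 2) (by decide) (by decide) (by decide)]
  refine mul_pos (mul_pos (mul_pos (mul_pos four_pos ?_) ?_) ?_) ?_ <;>
    apply sin_pi_mul_pos <;> linarith

/-- Where one triangle inequality fails and the perimeter is less than one, the spectral
discriminant is negative. -/
lemma spectralDiscr_neg_of_triangle (hW : ∀ k, W k < 1 ∧ W k ≠ 0) {t : ℝ} (ht : 0 < t)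
    {i j k : Fin 3} (hij : i ≠ j) (hjk : j ≠ k) (hik : i ≠ k)
    (h : |neck (t * W j)| + |neck (t * W k)| < |neck (t * W i)|)
    (hS : |neck (t * W i)| + |neck (t * W j)| + |neck (t * W k)| < 1) :
    spectralDiscr W t < 0 := by
  have hpos : ∀ k, 0 < |neck (t * W k)| := fun k =>
    abs_neck_pos (mul_ne_zero ht.ne' (hW k).2)
  have hi := hpos i
  have hj := hpos j
  have hk := hpos k
  rw [spectralDiscr_eq W t hij hjk hik]
  refine mul_neg_of_neg_of_pos (mul_neg_of_neg_of_pos (mul_neg_of_pos_of_neg (mul_pos four_pos ?_)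
    ?_) ?_) ?_
  · apply sin_pi_mul_pos <;> linarith
  · apply sin_pi_mul_neg <;> linarith
  · apply sin_pi_mul_pos <;> linarith
  · apply sin_pi_mul_pos <;> linarith

lemma neck_eq_div {w : ℝ} (hw : w ≤ 1) : neck w = w / (2 * (1 + √(1 - w))) := by
  have h1 := Real.sq_sqrt (sub_nonneg.2 hw)
  have h2 := Real.sqrt_nonneg (1 - w)
  rw [eq_div_iff (by positivity)]
  unfold neck
  linear_combination (-1) * h1

lemma abs_neck_eq_div {w : ℝ} (hw : w ≤ 1) : |neck w| = |w| / (2 * (1 + √(1 - w))) := by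
  rw [neck_eq_div hw, abs_div, abs_of_pos (a := 2 * _) (by positivity)]

/-- The small-`t` behaviour of the spectral discriminant sees the weights. -/
lemma weightInequalities_of_spectralDiscr_nonneg (hW : ∀ k, W k < 1 ∧ W k ≠ 0)
    (h : ∀ t, 0 ≤ t → t ≤ 1 → 0 ≤ spectralDiscr W t) : WeightInequalities W := by
  intro i j k hij hjk hik
  by_contra! hcon
  have hc : Continuous fun t : ℝ => |W j| / (2 * (1 + √(1 - t * W j))) +
      |W k| / (2 * (1 + √(1 - t * W k))) - |W i| / (2 * (1 + √(1 - t * W i))) := by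
    have : ∀ x : ℝ, 2 * (1 + √x) ≠ 0 := fun x => by positivity
    fun_prop (disch := intro; positivity)
  have hS : Continuous fun t : ℝ => |neck (t * W i)| + |neck (t * W j)| + |neck (t * W k)| := by
    have := continuous_neck
    fun_prop
  have e1 := (hc.tendsto 0).eventually_lt_const (u := 0) (by
    simp only [zero_mul, sub_zero, Real.sqrt_one]
    linarith)
  have e2 := (hS.tendsto 0).eventually_lt_const (u := 1) (by simp [neck_zero])
  have e3 : ∀ᶠ t : ℝ in 𝓝[>] 0, t < 1 := nhdsWithin_le_nhds (eventually_lt_nhds one_pos)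
  obtain ⟨t, ⟨⟨⟨h1, h2⟩, h3⟩, h4⟩⟩ := ((((e1.and e2).filter_mono
    nhdsWithin_le_nhds).and e3).and (self_mem_nhdsWithin (s := Set.Ioi (0 : ℝ)))).exists
  have ht : 0 < t := h4
  have hd : ∀ m, |neck (t * W m)| = t * (|W m| / (2 * (1 + √(1 - t * W m)))) := fun m => by
    rw [abs_neck_eq_div (mul_lt_one_of_mem ht.le h3.le (hW m).1).le, abs_mul, abs_of_pos ht,
      mul_div_assoc]
  refine (h t ht.le h3.le).not_gt (spectralDiscr_neg_of_triangle hW ht hij hjk hik ?_ h2)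
  rw [hd, hd, hd]
  nlinarith

/-- If the perimeter exceeded one at `t = 1`, then it would pass one at some `t₀ < 1`, and just
beyond `t₀` it would be the only source of a negative sine factor. If a triangle inequality failed,
it would be at a positive weight, and exactly one sine factor would be negative at `t = 1`. -/
lemma neckInequalities_of_spectralDiscr_nonneg (hW : ∀ k, W k < 1 ∧ W k ≠ 0)
    (h : ∀ t, 0 ≤ t → t ≤ 1 → 0 ≤ spectralDiscr W t) : NeckInequalities W := by
  have hwt := weightInequalities_of_spectralDiscr_nonneg hW h
  refine ⟨?_, ?_⟩
  · by_contra! hcon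
    have hcn := continuous_neck
    have hS : Continuous fun t : ℝ => |neck (t * W 0)| + |neck (t * W 1)| + |neck (t * W 2)| := by
      fun_prop
    -- `t₀` is the parameter at which the perimeter reaches one
    obtain ⟨t₀, ht₀, hS₀⟩ := intermediate_value_Icc zero_le_one hS.continuousOn
      (show (1 : ℝ) ∈ _ by simp [neck_zero, hcon.le])
    simp only at hS₀
    have h0 : t₀ ≠ 0 := by rintro rfl; simp [neck_zero] at hS₀
    have h1 : t₀ ≠ 1 := by rintro rfl; simp at hS₀; linarith
    have h0' : 0 < t₀ := lt_of_le_of_ne ht₀.1 h0.symm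
    have h1' : t₀ < 1 := lt_of_le_of_ne ht₀.2 h1
    have hpos : ∀ t, 0 < t → ∀ k, 0 < |neck (t * W k)| := fun t ht k =>
      abs_neck_pos (mul_ne_zero ht.ne' (hW k).2)
    have e0 : ∀ᶠ t in 𝓝 t₀, |neck (t * W 1)| + |neck (t * W 2)| - |neck (t * W 0)| < 1 :=
      ((by fun_prop : Continuous fun t : ℝ => |neck (t * W 1)| + |neck (t * W 2)| -
        |neck (t * W 0)|).tendsto t₀).eventually_lt_const (by linarith [hpos t₀ h0' 0])
    have e1 : ∀ᶠ t in 𝓝 t₀, |neck (t * W 0)| + |neck (t * W 2)| - |neck (t * W 1)| < 1 :=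
      ((by fun_prop : Continuous fun t : ℝ => |neck (t * W 0)| + |neck (t * W 2)| -
        |neck (t * W 1)|).tendsto t₀).eventually_lt_const (by linarith [hpos t₀ h0' 1])
    have e2 : ∀ᶠ t in 𝓝 t₀, |neck (t * W 0)| + |neck (t * W 1)| - |neck (t * W 2)| < 1 :=
      ((by fun_prop : Continuous fun t : ℝ => |neck (t * W 0)| + |neck (t * W 1)| -
        |neck (t * W 2)|).tendsto t₀).eventually_lt_const (by linarith [hpos t₀ h0' 2])
    have e3 := (hS.tendsto t₀).eventually_lt_const (u := 2) (by linarith)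
    obtain ⟨t, ⟨⟨h3, h4, h5, h6⟩, h7⟩, h8⟩ := ((((e0.and (e1.and (e2.and e3))).and
      (eventually_lt_nhds h1')).filter_mono nhdsWithin_le_nhds).and
      (self_mem_nhdsWithin (s := Set.Ioi t₀))).exists
    have h8 : t₀ < t := h8
    have ht : 0 < t := h0'.trans h8
    have hSt : 1 < |neck (t * W 0)| + |neck (t * W 1)| + |neck (t * W 2)| := by
      have hm : ∀ k, |neck (t₀ * W k)| < |neck (t * W k)| := fun k =>
        abs_neck_mul_strictMono (hW k).1 (hW k).2 h0'.le h8 h7.le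
      linarith [hm 0, hm 1, hm 2]
    -- a triangle inequality at a positive weight follows from the perimeter exceeding one
    have key : ∀ i j k : Fin 3, i ≠ j → j ≠ k → i ≠ k →
        1 < |neck (t * W i)| + |neck (t * W j)| + |neck (t * W k)| →
        |neck (t * W i)| < |neck (t * W j)| + |neck (t * W k)| := by
      intro i j k hij hjk hik hs
      rcases (hW i).2.lt_or_gt with hi | hi
      · exact abs_neck_lt_of_neg hi (hW j).1 (hW j).2 (hW k).1 (hW k).2 (hwt i j k hij hjk hik) ht
          h7.le
      · have g1 := neck_lt_half (mul_lt_one_of_mem ht.le h7.le (hW i).1)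
        have g2 := neck_pos (mul_pos ht hi)
        rw [abs_of_pos g2] at hs ⊢
        linarith
    have k0 := key 0 1 2 (by decide) (by decide) (by decide) (by linarith)
    have k1 := key 1 0 2 (by decide) (by decide) (by decide) (by linarith)
    have k2 := key 2 0 1 (by decide) (by decide) (by decide) (by linarith)
    refine (h t ht.le h7.le).not_gt ?_
    rw [spectralDiscr_eq W t (i := 0) (j := 1) (k := 2) (by decide) (by decide) (by decide)]
    refine mul_neg_of_neg_of_pos (mul_neg_of_neg_of_pos (mul_neg_of_neg_of_pos
      (mul_neg_of_pos_of_neg four_pos ?_) ?_) ?_) ?_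
    · apply sin_pi_mul_neg' <;> linarith
    · apply sin_pi_mul_pos <;> linarith
    · apply sin_pi_mul_pos <;> linarith
    · apply sin_pi_mul_pos <;> linarith
  · intro i j k hij hjk hik
    rcases (hW i).2.lt_or_gt with hi | hi
    · simpa using (abs_neck_lt_of_neg hi (hW j).1 (hW j).2 (hW k).1 (hW k).2
        (hwt i j k hij hjk hik) one_pos le_rfl).le
    · by_contra! hcon
      have g1 := neck_lt_half (hW i).1
      have g2 := neck_pos hi
      have g3 : |neck (W i)| < 1 / 2 := by rwa [abs_of_pos g2]
      refine (h 1 zero_le_one le_rfl).not_gt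
        (spectralDiscr_neg_of_triangle hW one_pos hij hjk hik ?_ ?_) <;> simp only [one_mul]
      · exact hcon
      · linarith

end Inequalities

/-! ### Pairs of unimodular matrices with real traces -/

lemma det_commutator {A B : Matrix (Fin 2) (Fin 2) ℂ} (hA : A.det = 1) (hB : B.det = 1) :
    (A * B - B * A).det =
      4 - A.trace ^ 2 - B.trace ^ 2 - (A * B).trace ^ 2 + A.trace * B.trace * (A * B).trace := by
  rw [det_fin_two] at hA hB
  simp only [det_fin_two, trace_fin_two, Matrix.sub_apply, mul_apply, Fin.sum_univ_two]
  linear_combination (4 * (B 0 0 * B 1 1 - B 0 1 * B 1 0) - (B 0 0 + B 1 1) ^ 2) * hA +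
    (4 - (A 0 0 + A 1 1) ^ 2) * hB

/-- The discriminant of two unimodular matrices with real half traces is, up to a factor `4`, the
determinant of their commutator. -/
lemma det_commutator_eq_discr {A B : Matrix (Fin 2) (Fin 2) ℂ} (hA : A.det = 1) (hB : B.det = 1)
    {a b c : ℝ} (ha : A.trace = 2 * Real.cos a) (hb : B.trace = 2 * Real.cos b)
    (hc : (A * B).trace = 2 * Real.cos c) : (A * B - B * A).det = 4 * discr a b c := by
  rw [det_commutator hA hB, ha, hb, hc]
  simp only [discr]
  push_cast
  ring

lemma unitary_apply_one {U : Matrix (Fin 2) (Fin 2) ℂ} (hU : U ∈ unitaryGroup (Fin 2) ℂ)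
    (hdet : U.det = 1) : U 1 1 = star (U 0 0) ∧ U 1 0 = -star (U 0 1) := by
  have h1 : star U = U.adjugate := by
    have h := mem_unitaryGroup_iff'.1 hU
    calc star U = star U * (U * U.adjugate) := by rw [mul_adjugate, hdet, one_smul, mul_one]
      _ = U.adjugate := by rw [← mul_assoc, h, one_mul]
  rw [adjugate_fin_two] at h1
  have h2 := congrFun (congrFun h1 0) 0
  have h3 := congrFun (congrFun h1 1) 0
  simp only [star_apply, of_apply, cons_val', cons_val_zero, cons_val_one, cons_val_fin_one]
    at h2 h3
  exact ⟨h2.symm, by rw [h3, neg_neg]⟩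

lemma mem_unitaryGroup_of_apply_one {U : Matrix (Fin 2) (Fin 2) ℂ} (hdet : U.det = 1)
    (h1 : U 1 1 = star (U 0 0)) (h2 : U 1 0 = -star (U 0 1)) : U ∈ unitaryGroup (Fin 2) ℂ := by
  rw [mem_unitaryGroup_iff]
  have h : star U = U.adjugate := by
    rw [adjugate_fin_two]
    ext i j
    fin_cases i <;> fin_cases j <;> simp [star_apply, h1, h2]
  rw [h, mul_adjugate, hdet, one_smul]

/-- The commutator of two noncommuting elements of `SU₂` has positive determinant, as it is a
nonzero quaternion. -/
lemma discr_pos_of_mem_unitaryGroup {A B : Matrix (Fin 2) (Fin 2) ℂ}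
    (hAU : A ∈ unitaryGroup (Fin 2) ℂ) (hBU : B ∈ unitaryGroup (Fin 2) ℂ)
    (hA : A.det = 1) (hB : B.det = 1) {a b c : ℝ} (ha : A.trace = 2 * Real.cos a)
    (hb : B.trace = 2 * Real.cos b) (hc : (A * B).trace = 2 * Real.cos c)
    (hAB : A * B ≠ B * A) : 0 < discr a b c := by
  have h := det_commutator_eq_discr hA hB ha hb hc
  obtain ⟨a1, a2⟩ := unitary_apply_one hAU hA
  obtain ⟨b1, b2⟩ := unitary_apply_one hBU hB
  set D := A * B - B * A with hD
  have d1 : D 1 1 = star (D 0 0) := by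
    simp only [hD, Matrix.sub_apply, mul_apply, Fin.sum_univ_two, a1, a2, b1, b2, star_sub,
      star_add, star_mul', star_neg, star_star]
    ring
  have d2 : D 1 0 = -star (D 0 1) := by
    simp only [hD, Matrix.sub_apply, mul_apply, Fin.sum_univ_two, a1, a2, b1, b2, star_sub,
      star_add, star_mul', star_star]
    ring
  have hdet : D.det = ((Complex.normSq (D 0 0) + Complex.normSq (D 0 1) : ℝ) : ℂ) := by
    rw [det_fin_two, d1, d2, mul_neg, sub_neg_eq_add]
    push_cast
    rw [Complex.normSq_eq_conj_mul_self, Complex.normSq_eq_conj_mul_self, mul_comm (D 0 0),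
      mul_comm (D 0 1)]
    rfl
  rw [hdet] at h
  have h' : Complex.normSq (D 0 0) + Complex.normSq (D 0 1) = 4 * discr a b c := by exact_mod_cast h
  by_contra! hcon
  have n0 := Complex.normSq_nonneg (D 0 0)
  have n1 := Complex.normSq_nonneg (D 0 1)
  have z0 : D 0 0 = 0 := Complex.normSq_eq_zero.1 (by linarith)
  have z1 : D 0 1 = 0 := Complex.normSq_eq_zero.1 (by linarith)
  refine hAB (sub_eq_zero.1 ?_)
  rw [← hD]
  ext i j
  fin_cases i <;> fin_cases j <;> simp [z0, z1, d1, d2]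

lemma exists_conj_eq_diagonal {A : Matrix (Fin 2) (Fin 2) ℂ} {μ ν : ℂ} (hμν : μ ≠ ν)
    (htr : A.trace = μ + ν) (hdet : A.det = μ * ν) :
    ∃ P : GL (Fin 2) ℂ, (P : Matrix (Fin 2) (Fin 2) ℂ) * A = !![μ, 0; 0, ν] * P := by
  have key : ∀ x : ℂ, (x - μ) * (x - ν) = 0 → ∃ v : Fin 2 → ℂ, v ≠ 0 ∧
      v 0 * A 0 0 + v 1 * A 1 0 = x * v 0 ∧ v 0 * A 0 1 + v 1 * A 1 1 = x * v 1 := by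
    intro x hx
    have h : (A - x • (1 : Matrix (Fin 2) (Fin 2) ℂ)).det = 0 := by
      rw [trace_fin_two] at htr
      rw [det_fin_two] at hdet ⊢
      simp
      linear_combination hx + hdet - x * htr
    obtain ⟨v, hv, hv'⟩ := exists_vecMul_eq_zero_iff.2 h
    have h0 := congrFun hv' 0
    have h1 := congrFun hv' 1
    simp [vecMul, dotProduct, Fin.sum_univ_two] at h0 h1
    exact ⟨v, hv, by linear_combination h0, by linear_combination h1⟩
  obtain ⟨v, hv, hv0, hv1⟩ := key μ (by ring)
  obtain ⟨w, hw, hw0, hw1⟩ := key ν (by ring)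
  have hP : (!![v 0, v 1; w 0, w 1] : Matrix (Fin 2) (Fin 2) ℂ).det ≠ 0 := by
    intro hzero
    rw [det_fin_two_of] at hzero
    -- the eigenvectors would be proportional
    have h1 : v 0 * w 0 * (μ - ν) = 0 := by
      linear_combination (-w 0) * hv0 + v 0 * hw0 + A 1 0 * (-1) * hzero
    have h2 : v 1 * w 1 * (μ - ν) = 0 := by
      linear_combination (-w 1) * hv1 + v 1 * hw1 + A 0 1 * hzero
    have h3 : v 0 * w 0 = 0 := (mul_eq_zero.1 h1).resolve_right (sub_ne_zero.2 hμν)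
    have h4 : v 1 * w 1 = 0 := (mul_eq_zero.1 h2).resolve_right (sub_ne_zero.2 hμν)
    have h5 : v 0 * w 1 * (μ - ν) = 0 := by
      linear_combination (-w 1) * hv0 + v 1 * hw0 + (A 0 0 - ν) * hzero
    have h6 : v 0 * w 1 = 0 := (mul_eq_zero.1 h5).resolve_right (sub_ne_zero.2 hμν)
    have h7 : v 1 * w 0 = 0 := by linear_combination h6 - hzero
    have : ∀ u : Fin 2 → ℂ, u ≠ 0 → u 0 ≠ 0 ∨ u 1 ≠ 0 := fun u hu => by
      by_contra! hc
      exact hu (funext fun i => by fin_cases i <;> simp [hc])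
    rcases this v hv with a | a <;> rcases this w hw with b | b <;> simp_all
  refine ⟨GeneralLinearGroup.mkOfDetNeZero _ hP, ?_⟩
  ext i j
  fin_cases i <;> fin_cases j <;>
    simp [GeneralLinearGroup.mkOfDetNeZero, mul_apply, Fin.sum_univ_two, hv0, hv1, hw0, hw1]

/-- Two unimodular matrices with half traces `cos a`, `cos b`, `cos c` (the last one for the
product) of positive discriminant are simultaneously conjugate to unitary matrices. -/
lemma exists_unitarizer {A B : Matrix (Fin 2) (Fin 2) ℂ} (hA : A.det = 1) (hB : B.det = 1)
    {a b c : ℝ} (ha : A.trace = 2 * Real.cos a) (hb : B.trace = 2 * Real.cos b)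
    (hc : (A * B).trace = 2 * Real.cos c) (hd : 0 < discr a b c) :
    ∃ C : GL (Fin 2) ℂ,
      (C : Matrix (Fin 2) (Fin 2) ℂ) * A * (C⁻¹ : GL (Fin 2) ℂ) ∈ unitaryGroup (Fin 2) ℂ ∧
      (C : Matrix (Fin 2) (Fin 2) ℂ) * B * (C⁻¹ : GL (Fin 2) ℂ) ∈ unitaryGroup (Fin 2) ℂ := by
  set x := Real.cos a with hx
  set y := Real.cos b with hy
  set z := Real.cos c with hz
  have hd' : 0 < 1 - x ^ 2 - y ^ 2 - z ^ 2 + 2 * x * y * z := hd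
  have hx1 : 0 < 1 - x ^ 2 := by
    have h1 : x ^ 2 ≤ 1 := by simpa using Real.cos_sq_le_one a
    have h2 : y ^ 2 ≤ 1 := by simpa using Real.cos_sq_le_one b
    rcases h1.lt_or_eq with h | h
    · linarith
    · nlinarith [sq_nonneg (z - x * y)]
  have hxs : x ^ 2 + Real.sin a ^ 2 = 1 := by rw [add_comm]; exact Real.sin_sq_add_cos_sq a
  set s := Real.sin a with hs
  have hs0 : s ≠ 0 := by intro h; rw [h] at hxs; nlinarith
  have hxsC : (x : ℂ) ^ 2 + (s : ℂ) ^ 2 = 1 := by exact_mod_cast hxs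
  have hI := Complex.I_sq
  have hs0C : (s : ℂ) ≠ 0 := by exact_mod_cast hs0
  obtain ⟨P, hP⟩ := exists_conj_eq_diagonal (A := A) (μ := x + s * Complex.I)
    (ν := x - s * Complex.I) (fun h => hs0C (by
      have h1 : (s : ℂ) * Complex.I = 0 := by linear_combination h / 2
      simpa using h1)) (by rw [ha]; ring)
    (by rw [hA]; linear_combination -hxsC + (s : ℂ) ^ 2 * hI)
  have hPi : (P : Matrix (Fin 2) (Fin 2) ℂ) * (P⁻¹ : GL (Fin 2) ℂ) = 1 := by simp
  have hPi' : ((P⁻¹ : GL (Fin 2) ℂ) : Matrix (Fin 2) (Fin 2) ℂ) * P = 1 := by simp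
  set B' := (P : Matrix (Fin 2) (Fin 2) ℂ) * B * (P⁻¹ : GL (Fin 2) ℂ) with hB'
  have hB'det : B'.det = 1 := by
    rw [hB', det_mul, det_mul, mul_right_comm, ← det_mul, hPi, hB, det_one, one_mul]
  have hB'tr : B'.trace = 2 * y := by
    rw [hB', trace_mul_comm, ← mul_assoc, hPi', one_mul, hb]
  have hA' : (P : Matrix (Fin 2) (Fin 2) ℂ) * A * (P⁻¹ : GL (Fin 2) ℂ) =
      !![x + s * Complex.I, 0; 0, x - s * Complex.I] := by
    rw [hP, mul_assoc, hPi, mul_one]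
  have hAB'tr : (!![x + s * Complex.I, 0; 0, x - s * Complex.I] * B').trace = 2 * z := by
    rw [← hA', hB', ← hc]
    calc _ = ((P : Matrix (Fin 2) (Fin 2) ℂ) * (A * (((P⁻¹ : GL (Fin 2) ℂ) :
          Matrix (Fin 2) (Fin 2) ℂ) * P) * B) * (P⁻¹ : GL (Fin 2) ℂ)).trace := by
            simp only [mul_assoc]
      _ = _ := by rw [hPi', mul_one, trace_mul_comm, ← mul_assoc, hPi', one_mul]
  rw [det_fin_two] at hB'det
  rw [trace_fin_two] at hB'tr hAB'tr
  simp only [mul_apply, Fin.sum_univ_two, of_apply, cons_val', cons_val_zero, cons_val_one,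
    cons_val_fin_one, zero_mul, add_zero, zero_add] at hAB'tr
  set p := B' 0 0 with hp
  set q := B' 0 1 with hq
  set r := B' 1 0 with hr
  set m := B' 1 1 with hm
  have e1 : (s : ℂ) * Complex.I * p = z - (x - s * Complex.I) * y := by
    linear_combination hAB'tr / 2 - (x - s * Complex.I) * hB'tr / 2
  have e2 : -((s : ℂ) * Complex.I) * m = z - (x + s * Complex.I) * y := by
    linear_combination hAB'tr / 2 - (x + s * Complex.I) * hB'tr / 2
  have hm' : m = star p := by
    have e3 := congrArg star e1
    simp only [Complex.star_def, map_mul, map_sub, Complex.conj_ofReal, Complex.conj_I] at e3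
    apply mul_left_cancel₀ (neg_ne_zero.2 (mul_ne_zero hs0C Complex.I_ne_zero))
    rw [e2, Complex.star_def]
    linear_combination -e3
  set k := (1 - x ^ 2 - y ^ 2 - z ^ 2 + 2 * x * y * z) / s ^ 2 with hk
  have hs2 : 0 < s ^ 2 := by positivity
  have hk0 : 0 < k := div_pos hd' hs2
  have hqr : q * r = -k := by
    have h1 : (s : ℂ) ^ 2 * (p * m) = z ^ 2 - 2 * x * y * z + y ^ 2 := by
      linear_combination (-(s : ℂ) * Complex.I * m) * e1 + (z - (x - s * Complex.I) * y) * e2 +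
        (s : ℂ) ^ 2 * p * m * hI + (y : ℂ) ^ 2 * hxsC - (s : ℂ) ^ 2 * (y : ℂ) ^ 2 * hI
    have h2 : (s : ℂ) ^ 2 * k = 1 - x ^ 2 - y ^ 2 - z ^ 2 + 2 * x * y * z := by
      rw [hk]; push_cast; field_simp
    apply mul_left_cancel₀ (pow_ne_zero 2 hs0C)
    linear_combination h1 + h2 - (s : ℂ) ^ 2 * hB'det - hxsC
  have hq0 : q ≠ 0 := by
    intro h
    rw [h, zero_mul] at hqr
    have : (k : ℂ) = 0 := by linear_combination hqr
    exact hk0.ne' (by exact_mod_cast this)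
  -- rescaling the first eigenvector by `d` balances the off-diagonal entries
  set d := Real.sqrt (k / Complex.normSq q) with hdd
  have hnq : 0 < Complex.normSq q := Complex.normSq_pos.2 hq0
  have hd0 : 0 < d := Real.sqrt_pos.2 (by positivity)
  have hd0C : (d : ℂ) ≠ 0 := by exact_mod_cast hd0.ne'
  have hd2 : (d : ℂ) ^ 2 * (q * star q) = k := by
    have h1 : d ^ 2 * Complex.normSq q = k := by
      rw [hdd, Real.sq_sqrt (by positivity)]; field_simp
    rw [Complex.star_def, Complex.mul_conj]
    exact_mod_cast h1
  have hr' : r = -((d : ℂ) ^ 2 * star q) := by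
    apply mul_left_cancel₀ hq0
    linear_combination hqr + hd2
  have hQdet : (!![(d : ℂ), 0; 0, 1] : Matrix (Fin 2) (Fin 2) ℂ).det ≠ 0 := by
    simpa [det_fin_two_of] using hd0C
  set Q : GL (Fin 2) ℂ := GeneralLinearGroup.mkOfDetNeZero _ hQdet with hQ
  have hQv : (Q : Matrix (Fin 2) (Fin 2) ℂ) = !![(d : ℂ), 0; 0, 1] := rfl
  have hQi : ((Q⁻¹ : GL (Fin 2) ℂ) : Matrix (Fin 2) (Fin 2) ℂ) = !![(d : ℂ)⁻¹, 0; 0, 1] := by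
    rw [coe_units_inv, hQv]
    refine inv_eq_right_inv ?_
    ext i j
    fin_cases i <;> fin_cases j <;> simp [hd0C]
  have hconj : ∀ M : Matrix (Fin 2) (Fin 2) ℂ,
      ((Q * P : GL (Fin 2) ℂ) : Matrix (Fin 2) (Fin 2) ℂ) * M *
        (((Q * P)⁻¹ : GL (Fin 2) ℂ) : Matrix (Fin 2) (Fin 2) ℂ) =
      !![(d : ℂ), 0; 0, 1] * ((P : Matrix (Fin 2) (Fin 2) ℂ) * M * (P⁻¹ : GL (Fin 2) ℂ)) *
        !![(d : ℂ)⁻¹, 0; 0, 1] := by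
    intro M
    rw [_root_.mul_inv_rev, Units.val_mul, Units.val_mul, hQi, hQv]
    simp only [mul_assoc]
  have hdi : (d : ℂ) * (d : ℂ)⁻¹ = 1 := mul_inv_cancel₀ hd0C
  refine ⟨Q * P, ?_, ?_⟩
  · rw [hconj, hA']
    apply mem_unitaryGroup_of_apply_one
    · simp only [det_mul, det_fin_two_of]
      linear_combination (x ^ 2 - s ^ 2 * Complex.I ^ 2) * hdi + hxsC - (s : ℂ) ^ 2 * hI
    · simp [mul_apply, Fin.sum_univ_two]
      linear_combination (-(x - s * Complex.I)) * hdi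
    · simp [mul_apply, Fin.sum_univ_two]
  · rw [hconj, ← hB']
    have hB'eq : B' = !![p, q; r, m] := eta_fin_two B'
    apply mem_unitaryGroup_of_apply_one
    · rw [hB'eq]
      simp only [det_mul, det_fin_two_of]
      linear_combination (p * m - q * r) * hdi + hB'det
    · rw [hB'eq, hm']
      simp [mul_apply, Fin.sum_univ_two]
      field_simp
    · rw [hB'eq, hr']
      simp [mul_apply, Fin.sum_univ_two]
      field_simp

/-! ### Sections and deck transformations of the universal cover -/

section Covering

variable {X : Type*} [TopologicalSpace X] {p : X → Base}

/-- A continuous section of `p` over a subset `U` of `ℂ`, as a function on all of `ℂ` whose values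
outside `U` are irrelevant. -/
structure IsSection (p : X → Base) (s : ℂ → X) (U : Set ℂ) : Prop where
  continuousOn : ContinuousOn s U
  proj : ∀ z ∈ U, (p (s z) : ℂ) = z

lemma IsSection.mono {s : ℂ → X} {U V : Set ℂ} (hs : IsSection p s U) (h : V ⊆ U) :
    IsSection p s V :=
  ⟨hs.continuousOn.mono h, fun z hz => hs.proj z (h hz)⟩

lemma isOpen_base : IsOpen {z : ℂ | z ≠ 0 ∧ z ≠ 1} :=
  isOpen_ne.inter isOpen_ne

lemma IsUniversalCover.isLocalHomeomorph (hp : IsUniversalCover p) :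
    IsLocalHomeomorph fun x => (p x : ℂ) :=
  isOpen_base.isOpenEmbedding_subtypeVal.isLocalHomeomorph.comp hp.isCoveringMap.isLocalHomeomorph

lemma _root_.IsLocalHomeomorph.locallyPathConnectedSpace {Y Z : Type*} [TopologicalSpace Y]
    [TopologicalSpace Z] [LocallyPathConnectedSpace Z] {f : Y → Z} (hf : IsLocalHomeomorph f) :
    LocallyPathConnectedSpace Y := by
  rw [locallyPathConnectedSpace_iff_pathComponentIn_mem_nhds]
  intro x u hu hxu
  obtain ⟨e, hxe, -⟩ := hf x
  have hV : e.symm ⁻¹' u ∈ 𝓝 (e x) := by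
    have := e.continuousAt_symm (e.map_source hxe)
    apply this
    rw [e.left_inv hxe]
    exact hu.mem_nhds hxu
  have hV' : e.symm ⁻¹' u ∩ e.target ∈ 𝓝 (e x) :=
    inter_mem hV (e.open_target.mem_nhds (e.map_source hxe))
  obtain ⟨V, ⟨hVn, hVc⟩, hVs⟩ := (path_connected_basis (e x)).mem_iff.1 hV'
  have hcont : ContinuousOn e.symm V := e.continuousOn_symm.mono fun z hz => (hVs hz).2
  have h1 : IsPathConnected (e.symm '' V) := hVc.image' hcont
  have h2 : e.symm '' V ⊆ u := Set.image_subset_iff.2 fun z hz => (hVs hz).1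
  have h3 : e.symm '' V ⊆ pathComponentIn u x :=
    h1.subset_pathComponentIn ⟨e x, mem_of_mem_nhds hVn, e.left_inv hxe⟩ h2
  refine mem_of_superset ?_ h3
  have h4 : ∀ᶠ y in 𝓝 x, e y ∈ V := (e.continuousAt hxe) hVn
  filter_upwards [h4, e.open_source.mem_nhds hxe] with y hy hys
  exact ⟨e y, hy, e.left_inv hys⟩

/-- The deck group is transitive on fibres: `p` lifts through itself in both directions, by the
lifting criterion for simply connected spaces. -/
lemma IsUniversalCover.exists_deck (hp : IsUniversalCover p) {x y : X} (h : p x = p y) :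
    ∃ τ ∈ deck p, τ x = y := by
  have := hp.simplyConnected
  have := hp.isLocalHomeomorph.locallyPathConnectedSpace
  have hc := hp.isCoveringMap
  let f : C(X, Base) := ⟨p, hc.continuous⟩
  obtain ⟨F, ⟨hF, hFp⟩, -⟩ := hc.existsUnique_continuousMap_lifts f x y h.symm
  obtain ⟨F', ⟨hF', hFp'⟩, -⟩ := hc.existsUnique_continuousMap_lifts f y x h
  have h1 : F' ∘ F = id := hc.eq_of_comp_eq (F'.continuous.comp F.continuous) continuous_id
    (by rw [← Function.comp_assoc, hFp']; exact hFp) x (by simp [hF, hF'])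
  have h2 : F ∘ F' = id := hc.eq_of_comp_eq (F.continuous.comp F'.continuous) continuous_id
    (by rw [← Function.comp_assoc, hFp]; exact hFp') y (by simp [hF, hF'])
  exact ⟨⟨⟨F, F', congrFun h1, congrFun h2⟩, F.continuous, F'.continuous⟩, congrFun hFp, hF⟩

lemma IsUniversalCover.exists_section (hp : IsUniversalCover p) {U : Set ℂ} (hU : IsOpen U)
    (hne : ∀ z ∈ U, z ≠ 0 ∧ z ≠ 1) {c : ℂ} (hstar : StarConvex ℝ c U)
    {x : X} (hx : (p x : ℂ) ∈ U) : ∃ s, IsSection p s U ∧ s (p x) = x := by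
  classical
  have := hU.locallyPathConnectedSpace
  have : ContractibleSpace U := hstar.contractibleSpace ⟨_, hx⟩
  let f : C(U, Base) := ⟨fun z => ⟨z, hne z z.2⟩, by fun_prop⟩
  obtain ⟨F, ⟨hF, hFp⟩, -⟩ :=
    hp.isCoveringMap.existsUnique_continuousMap_lifts f ⟨p x, hx⟩ x rfl
  have hr : ∀ z (hz : z ∈ U), (if h : z ∈ U then F ⟨z, h⟩ else x) = F ⟨z, hz⟩ :=
    fun z hz => dif_pos hz
  refine ⟨fun z => if h : z ∈ U then F ⟨z, h⟩ else x, ⟨?_, fun z hz => ?_⟩, ?_⟩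
  · rw [continuousOn_iff_continuous_domRestrict]
    convert F.continuous using 1
    ext z
    exact hr z z.2
  · simp only [hr z hz]
    exact congrArg Subtype.val (congrFun hFp ⟨z, hz⟩)
  · simp only [hr _ hx]
    exact hF

/-- Around each point of the total space there is a local section over a disc. -/
lemma IsUniversalCover.exists_local_section (hp : IsUniversalCover p) (x : X) {V : Set ℂ}
    (hV : V ∈ 𝓝 (p x : ℂ)) : ∃ (ε : ℝ) (s : ℂ → X), 0 < ε ∧ Metric.ball (p x : ℂ) ε ⊆ V ∧
      IsSection p s (Metric.ball (p x : ℂ) ε) ∧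
      ∀ᶠ y in 𝓝 x, (p y : ℂ) ∈ Metric.ball (p x : ℂ) ε ∧ s (p y) = y := by
  obtain ⟨e, hxe, he⟩ := hp.isLocalHomeomorph x
  have he' : ∀ y, (p y : ℂ) = e y := congrFun he
  obtain ⟨ε, hε, hball⟩ := Metric.mem_nhds_iff.1
    (inter_mem hV (e.open_target.mem_nhds (by rw [he']; exact e.map_source hxe)))
  refine ⟨ε, e.symm, hε, fun z hz => (hball hz).1,
    ⟨e.continuousOn_symm.mono fun z hz => (hball hz).2, fun z hz => ?_⟩, ?_⟩
  · rw [he', e.right_inv (hball hz).2]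
  · have hcont : ContinuousAt (fun y => (p y : ℂ)) x := hp.isLocalHomeomorph.continuous.continuousAt
    filter_upwards [hcont (Metric.ball_mem_nhds _ hε), e.open_source.mem_nhds hxe] with y hy hys
    exact ⟨hy, by rw [he', e.left_inv hys]⟩

/-! ### Flat maps and their monodromy -/

/-- A map from the total space to a group is flat if any two of its branches over a connected open
set differ by left multiplication by a constant. -/
def IsFlat {G : Type*} [Group G] (p : X → Base) (g : X → G) : Prop :=
  ∀ (U : Set ℂ) (s s' : ℂ → X), IsOpen U → IsPreconnected U → IsSection p s U →
    IsSection p s' U → ∀ z ∈ U, ∀ w ∈ U, g (s' z) * (g (s z))⁻¹ = g (s' w) * (g (s w))⁻¹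

variable {G : Type*} [Group G] {g : X → G}

lemma IsFlat.eventually_eq (hg : IsFlat p g) (hp : IsUniversalCover p) {s : ℂ → X} {U : Set ℂ}
    (hU : IsOpen U) (hs : IsSection p s U) {y : X} (hy : (p y : ℂ) ∈ U) :
    ∀ᶠ y' in 𝓝 y, g y' * (g (s (p y')))⁻¹ = g y * (g (s (p y)))⁻¹ := by
  obtain ⟨ε, σ, hε, hball, hσ, hev⟩ := hp.exists_local_section y (hU.mem_nhds hy)
  filter_upwards [hev] with y' hy'
  have h := hg _ s σ Metric.isOpen_ball (convex_ball _ _).isPreconnected (hs.mono hball) hσ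
    (p y') hy'.1 (p y) (Metric.mem_ball_self hε)
  rwa [hy'.2, hev.self_of_nhds.2] at h

/-- The monodromy of a flat map does not depend on the base point. -/
lemma IsFlat.deck_eq (hg : IsFlat p g) (hp : IsUniversalCover p) {τ : X ≃ₜ X} (hτ : τ ∈ deck p)
    (x y : X) : g (τ x) * (g x)⁻¹ = g (τ y) * (g y)⁻¹ := by
  have := hp.simplyConnected
  have h : IsLocallyConstant fun x => g (τ x) * (g x)⁻¹ := by
    rw [IsLocallyConstant.iff_eventually_eq]
    intro y
    obtain ⟨ε, σ, hε, -, hσ, hev⟩ := hp.exists_local_section y univ_mem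
    filter_upwards [hev] with y' hy'
    have hτσ : IsSection p (fun z => τ (σ z)) (Metric.ball (p y : ℂ) ε) :=
      ⟨τ.continuous.comp_continuousOn hσ.continuousOn, fun z hz => by rw [hτ]; exact hσ.proj z hz⟩
    have h := hg _ σ _ Metric.isOpen_ball (convex_ball _ _).isPreconnected hσ hτσ
      (p y') hy'.1 (p y) (Metric.mem_ball_self hε)
    rwa [hy'.2, hev.self_of_nhds.2] at h
  exact h.apply_eq_of_preconnectedSpace x y

/-! ### The two slit planes -/

/-- The plane slit along the two rays which start at `0` and `1` and point away from `c`. -/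
def slitDomain (c : ℂ) : Set ℂ :=
  {z | z / c ∈ Complex.slitPlane ∧ (z - 1) / (c - 1) ∈ Complex.slitPlane}

lemma isOpen_slitDomain (c : ℂ) : IsOpen (slitDomain c) :=
  (Complex.isOpen_slitPlane.preimage (by fun_prop : Continuous fun z : ℂ => z / c)).inter
    (Complex.isOpen_slitPlane.preimage (by fun_prop : Continuous fun z : ℂ => (z - 1) / (c - 1)))

lemma ne_of_mem_slitDomain {c z : ℂ} (hz : z ∈ slitDomain c) : z ≠ 0 ∧ z ≠ 1 := by
  constructor <;> rintro rfl
  · exact Complex.slitPlane_ne_zero hz.1 (by simp)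
  · exact Complex.slitPlane_ne_zero hz.2 (by simp)

lemma starConvex_slitDomain {c : ℂ} (h0 : c ≠ 0) (h1 : c ≠ 1) : StarConvex ℝ c (slitDomain c) := by
  intro z hz a b ha hb hab
  have h1' : c - 1 ≠ 0 := sub_ne_zero.2 h1
  have habC : (a : ℂ) + b = 1 := by exact_mod_cast hab
  refine ⟨?_, ?_⟩
  · have := Complex.starConvex_one_slitPlane hz.1 ha hb hab
    convert this using 1
    simp only [Complex.real_smul]
    field_simp
  · have := Complex.starConvex_one_slitPlane hz.2 ha hb hab
    convert this using 1
    simp only [Complex.real_smul]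
    field_simp
    linear_combination habC

lemma mem_slitDomain_I {z : ℂ} :
    z ∈ slitDomain Complex.I ↔ (0 < z.im ∨ z.re ≠ 0) ∧ (z.re - 1 < z.im ∨ z.re - 1 + z.im ≠ 0) := by
  have h1 : z / Complex.I = -(z * Complex.I) := by
    rw [div_eq_iff Complex.I_ne_zero]
    linear_combination z * Complex.I_sq
  have h2 : (z - 1) / (Complex.I - 1) = -((z - 1) * (1 + Complex.I)) / 2 := by
    have : Complex.I - 1 ≠ 0 := fun h => by simpa using congrArg Complex.re h
    rw [div_eq_div_iff this two_ne_zero]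
    linear_combination (-(z - 1)) * (-1) * (Complex.I_sq)
  simp only [slitDomain, Set.mem_ofPred_eq, h1, h2, Complex.mem_slitPlane_iff]
  simp
  intro _
  constructor <;> rintro (hb | hb)
  · left; linarith
  · right; contrapose! hb; linarith
  · left; linarith
  · right; contrapose! hb; linarith

lemma mem_slitDomain_neg_I {z : ℂ} : z ∈ slitDomain (-Complex.I) ↔
    (z.im < 0 ∨ z.re ≠ 0) ∧ (z.re - 1 < -z.im ∨ z.re - 1 - z.im ≠ 0) := by
  have h1 : z / -Complex.I = z * Complex.I := by
    rw [div_eq_iff (neg_ne_zero.2 Complex.I_ne_zero)]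
    linear_combination z * Complex.I_sq
  have h2 : (z - 1) / (-Complex.I - 1) = -((z - 1) * (1 - Complex.I)) / 2 := by
    have : -Complex.I - 1 ≠ 0 := fun h => by simpa using congrArg Complex.re h
    rw [div_eq_div_iff this two_ne_zero]
    linear_combination (z - 1) * (Complex.I_sq)
  simp only [slitDomain, Set.mem_ofPred_eq, h1, h2, Complex.mem_slitPlane_iff]
  simp
  intro _
  constructor <;> rintro (hb | hb)
  · left; linarith
  · right; contrapose! hb; linarith
  · left; linarith
  · right; contrapose! hb; linarith

lemma mem_slitDomain_I_of_im_nonneg {z : ℂ} (hz : 0 ≤ z.im) (h : z ≠ 0 ∧ z ≠ 1) :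
    z ∈ slitDomain Complex.I := by
  rw [mem_slitDomain_I]
  rcases hz.lt_or_eq with hz | hz
  · exact ⟨Or.inl hz, by by_contra! hc; linarith [hc.1, hc.2]⟩
  · refine ⟨Or.inr fun h0 => h.1 (Complex.ext h0 hz.symm), Or.inr fun h0 => h.2 (Complex.ext ?_ ?_)⟩
    · simp; linarith
    · simp [← hz]

lemma mem_slitDomain_neg_I_of_im_nonpos {z : ℂ} (hz : z.im ≤ 0) (h : z ≠ 0 ∧ z ≠ 1) :
    z ∈ slitDomain (-Complex.I) := by
  rw [mem_slitDomain_neg_I]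
  rcases hz.lt_or_eq with hz | hz
  · exact ⟨Or.inl hz, by by_contra! hc; linarith [hc.1, hc.2]⟩
  · refine ⟨Or.inr fun h0 => h.1 (Complex.ext h0 hz), Or.inr fun h0 => h.2 (Complex.ext ?_ ?_)⟩
    · simp; linarith
    · simp [hz]

/-- A pair of sections over the two slit planes which agree at `1/2`. -/
structure SectionPair (p : X → Base) (s₁ s₂ : ℂ → X) : Prop where
  upper : IsSection p s₁ (slitDomain Complex.I)
  lower : IsSection p s₂ (slitDomain (-Complex.I))
  eq_half : s₁ (1 / 2) = s₂ (1 / 2)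

lemma half_mem_slitDomain :
    (1 / 2 : ℂ) ∈ slitDomain Complex.I ∧ (1 / 2 : ℂ) ∈ slitDomain (-Complex.I) := by
  have h : (1 / 2 : ℂ) ≠ 0 ∧ (1 / 2 : ℂ) ≠ 1 := by norm_num
  exact ⟨mem_slitDomain_I_of_im_nonneg (by simp) h, mem_slitDomain_neg_I_of_im_nonpos (by simp) h⟩

lemma IsUniversalCover.exists_section_slitDomain (hp : IsUniversalCover p) {c : ℂ} (h0 : c ≠ 0)
    (h1 : c ≠ 1) {x : X} (hx : (p x : ℂ) ∈ slitDomain c) :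
    ∃ s, IsSection p s (slitDomain c) ∧ s (p x) = x :=
  hp.exists_section (isOpen_slitDomain c) (fun _ => ne_of_mem_slitDomain)
    (starConvex_slitDomain h0 h1) hx

lemma IsUniversalCover.exists_sectionPair (hp : IsUniversalCover p) :
    ∃ s₁ s₂ : ℂ → X, SectionPair p s₁ s₂ := by
  have := hp.simplyConnected
  have hI : Complex.I ≠ 0 ∧ Complex.I ≠ 1 := ⟨Complex.I_ne_zero, fun h => by
    simpa using congrArg Complex.re h⟩
  have hI' : -Complex.I ≠ 0 ∧ -Complex.I ≠ 1 := ⟨neg_ne_zero.2 Complex.I_ne_zero, fun h => by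
    simpa using congrArg Complex.re h⟩
  obtain ⟨x⟩ : Nonempty X := inferInstance
  obtain ⟨y, hy⟩ : ∃ y : X, (p y : ℂ) = 1 / 2 := by
    rcases le_total 0 (p x : ℂ).im with h | h
    · obtain ⟨s, hs, -⟩ := hp.exists_section_slitDomain hI.1 hI.2
        (mem_slitDomain_I_of_im_nonneg h (p x).2)
      exact ⟨_, hs.proj _ half_mem_slitDomain.1⟩
    · obtain ⟨s, hs, -⟩ := hp.exists_section_slitDomain hI'.1 hI'.2
        (mem_slitDomain_neg_I_of_im_nonpos h (p x).2)
      exact ⟨_, hs.proj _ half_mem_slitDomain.2⟩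
  obtain ⟨s₁, hs₁, h₁⟩ := hp.exists_section_slitDomain hI.1 hI.2 (x := y)
    (hy ▸ half_mem_slitDomain.1)
  obtain ⟨s₂, hs₂, h₂⟩ := hp.exists_section_slitDomain hI'.1 hI'.2 (x := y)
    (hy ▸ half_mem_slitDomain.2)
  rw [hy] at h₁ h₂
  exact ⟨s₁, s₂, hs₁, hs₂, h₁.trans h₂.symm⟩

variable {s₁ s₂ : ℂ → X}

/-- The two branches of a flat map differ by a constant along each component of
`ℝ ∖ {0, 1}`. -/
lemma IsFlat.transition_eq (hg : IsFlat p g) (hs : SectionPair p s₁ s₂) {U : Set ℂ} (hU : IsOpen U)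
    (hc : Convex ℝ U) (h : ∀ z ∈ U, z.re ≠ 0 ∧ z.re - 1 + z.im ≠ 0 ∧ z.re - 1 - z.im ≠ 0)
    {z w : ℂ} (hz : z ∈ U) (hw : w ∈ U) :
    g (s₂ z) * (g (s₁ z))⁻¹ = g (s₂ w) * (g (s₁ w))⁻¹ :=
  hg U s₁ s₂ hU hc.isPreconnected
    (hs.upper.mono fun z hz => mem_slitDomain_I.2 ⟨Or.inr (h z hz).1, Or.inr (h z hz).2.1⟩)
    (hs.lower.mono fun z hz => mem_slitDomain_neg_I.2 ⟨Or.inr (h z hz).1, Or.inr (h z hz).2.2⟩)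
    z hz w hw

lemma IsFlat.transition_left (hg : IsFlat p g) (hs : SectionPair p s₁ s₂) {x : ℝ} (hx : x < 0) :
    g (s₂ x) * (g (s₁ x))⁻¹ = g (s₂ (-1)) * (g (s₁ (-1)))⁻¹ := by
  refine hg.transition_eq hs (U := {z | z.re < 0 ∧ z.re - 1 + z.im < 0 ∧ z.re - 1 - z.im < 0})
    ?_ ?_ (fun z hz => ⟨hz.1.ne, hz.2.1.ne, hz.2.2.ne⟩) ?_ ?_
  · refine (isOpen_lt ?_ ?_).and ((isOpen_lt ?_ ?_).and (isOpen_lt ?_ ?_)) <;> fun_prop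
  · intro z hz w hw a b ha hb hab
    simp at hz hw ⊢
    refine ⟨?_, ?_, ?_⟩ <;> rcases ha.eq_or_lt with rfl | ha <;> nlinarith
  · simp; refine ⟨hx, ?_⟩; linarith
  · norm_num

lemma IsFlat.transition_middle (hg : IsFlat p g) (hs : SectionPair p s₁ s₂) {x : ℝ} (hx : 0 < x)
    (hx1 : x < 1) : g (s₂ x) * (g (s₁ x))⁻¹ = 1 := by
  have : g (s₂ x) * (g (s₁ x))⁻¹ = g (s₂ (1 / 2)) * (g (s₁ (1 / 2)))⁻¹ := by
    refine hg.transition_eq hs (U := {z | 0 < z.re ∧ z.re - 1 + z.im < 0 ∧ z.re - 1 - z.im < 0})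
      ?_ ?_ (fun z hz => ⟨hz.1.ne', hz.2.1.ne, hz.2.2.ne⟩) ?_ ?_
    · refine (isOpen_lt ?_ ?_).and ((isOpen_lt ?_ ?_).and (isOpen_lt ?_ ?_)) <;> fun_prop
    · intro z hz w hw a b ha hb hab
      simp at hz hw ⊢
      refine ⟨?_, ?_, ?_⟩ <;> rcases ha.eq_or_lt with rfl | ha <;> nlinarith
    · simp; exact ⟨hx, hx1⟩
    · norm_num
  rw [this, hs.eq_half, mul_inv_cancel]

lemma IsFlat.transition_right (hg : IsFlat p g) (hs : SectionPair p s₁ s₂) {x : ℝ} (hx : 1 < x) :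
    g (s₂ x) * (g (s₁ x))⁻¹ = g (s₂ 2) * (g (s₁ 2))⁻¹ := by
  refine hg.transition_eq hs (U := {z | 0 < z.re ∧ 0 < z.re - 1 + z.im ∧ 0 < z.re - 1 - z.im})
    ?_ ?_ (fun z hz => ⟨hz.1.ne', hz.2.1.ne', hz.2.2.ne'⟩) ?_ ?_
  · refine (isOpen_lt ?_ ?_).and ((isOpen_lt ?_ ?_).and (isOpen_lt ?_ ?_)) <;> fun_prop
  · intro z hz w hw a b ha hb hab
    simp at hz hw ⊢
    refine ⟨?_, ?_, ?_⟩ <;> rcases ha.eq_or_lt with rfl | ha <;> nlinarith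
  · simp; exact ⟨by linarith, hx⟩
  · norm_num

/-- The monodromy group of a flat map is generated by the monodromies around `0` and `1`: the left
coset of `g y` relative to the branches of `g` on the slit planes is locally constant in `y`. -/
lemma IsFlat.monodromy_mem_closure (hg : IsFlat p g) (hp : IsUniversalCover p)
    (hs : SectionPair p s₁ s₂) {τ : X ≃ₜ X} (hτ : τ ∈ deck p) (x : X) :
    g (τ x) * (g x)⁻¹ ∈ Subgroup.closure
      {g (s₂ (-1)) * (g (s₁ (-1)))⁻¹, g (s₂ 2) * (g (s₁ 2))⁻¹} := by
  classical
  have := hp.simplyConnected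
  set A := g (s₂ (-1)) * (g (s₁ (-1)))⁻¹
  set B := g (s₂ 2) * (g (s₁ 2))⁻¹
  set H := Subgroup.closure {A, B}
  have htrans : ∀ z : ℂ, z.im = 0 → z ≠ 0 ∧ z ≠ 1 → g (s₂ z) * (g (s₁ z))⁻¹ ∈ H := by
    intro z hz hz'
    obtain ⟨r, rfl⟩ : ∃ r : ℝ, z = r := ⟨z.re, Complex.ext rfl (by simp [hz])⟩
    have h0 : r ≠ 0 := by exact_mod_cast hz'.1
    have h1 : r ≠ 1 := by exact_mod_cast hz'.2
    rcases h0.lt_or_gt with h | h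
    · rw [hg.transition_left hs h]
      exact Subgroup.subset_closure (by simp [A])
    · rcases h1.lt_or_gt with h' | h'
      · rw [hg.transition_middle hs h h']
        exact H.one_mem
      · rw [hg.transition_right hs h']
        exact Subgroup.subset_closure (by simp [B])
  let N₁ : X → G := fun y => g y * (g (s₁ (p y)))⁻¹
  let N₂ : X → G := fun y => g y * (g (s₂ (p y)))⁻¹
  let f : X → G ⧸ H := fun y => if 0 ≤ (p y : ℂ).im then (N₁ y : G ⧸ H) else (N₂ y : G ⧸ H)
  have hpc : Continuous fun y => (p y : ℂ).im :=
    Complex.continuous_im.comp hp.isLocalHomeomorph.continuous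
  have hf : IsLocallyConstant f := by
    rw [IsLocallyConstant.iff_eventually_eq]
    intro y
    have e1 : 0 ≤ (p y : ℂ).im → ∀ᶠ y' in 𝓝 y, N₁ y' = N₁ y := fun h =>
      hg.eventually_eq hp (isOpen_slitDomain _) hs.upper (mem_slitDomain_I_of_im_nonneg h (p y).2)
    have e2 : (p y : ℂ).im ≤ 0 → ∀ᶠ y' in 𝓝 y, N₂ y' = N₂ y := fun h =>
      hg.eventually_eq hp (isOpen_slitDomain _) hs.lower
        (mem_slitDomain_neg_I_of_im_nonpos h (p y).2)
    rcases lt_trichotomy (p y : ℂ).im 0 with h | h | h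
    · filter_upwards [e2 h.le, hpc.continuousAt.eventually_lt_const h] with y' h1 h2
      simp only [f, if_neg h.not_ge, if_neg h2.not_ge, h1]
    · have hN : (N₂ y : G ⧸ H) = N₁ y := by
        rw [QuotientGroup.eq]
        convert htrans _ h (p y).2 using 1
        simp only [N₁, N₂]
        group
      filter_upwards [e1 h.ge, e2 h.le] with y' h1 h2
      simp only [f, if_pos h.ge, h1, h2, hN, ite_self]
    · filter_upwards [e1 h.le, hpc.continuousAt.eventually_const_lt h] with y' h1 h2
      simp only [f, if_pos h.le, if_pos h2.le, h1]
  rw [hg.deck_eq hp hτ x (s₁ (1 / 2))]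
  have hhalf : (p (s₁ (1 / 2)) : ℂ) = 1 / 2 := hs.upper.proj _ half_mem_slitDomain.1
  have h1 := hf.apply_eq_of_preconnectedSpace (s₁ (1 / 2)) (τ (s₁ (1 / 2)))
  have him : 0 ≤ (1 / 2 : ℂ).im := by simp
  simp only [f, N₁, hτ _, hhalf, if_pos him] at h1
  rw [QuotientGroup.eq] at h1
  simpa using h1

end Covering

/-! ### Branches of a solution -/

section Solutions

/-- The solution at the loop parameter `l`, as a map to `GL₂(ℂ)`. -/
def solutionGL {X : Type*} (Φ : X → ℂ → Matrix (Fin 2) (Fin 2) ℂ) (l : ℂ)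
    (h : ∀ x, (Φ x l).det ≠ 0) (x : X) : GL (Fin 2) ℂ :=
  GeneralLinearGroup.mkOfDetNeZero (Φ x l) (h x)

lemma coe_solutionGL {X : Type*} {Φ : X → ℂ → Matrix (Fin 2) (Fin 2) ℂ} {l : ℂ}
    (h : ∀ x, (Φ x l).det ≠ 0) (x : X) :
    (solutionGL Φ l h x : Matrix (Fin 2) (Fin 2) ℂ) = Φ x l := rfl

variable {X : Type*} [TopologicalSpace X] {p : X → Base} {W : Fin 3 → ℝ}
  {Φ : X → ℂ → Matrix (Fin 2) (Fin 2) ℂ}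

lemma SolvesODE.hasDerivAt_section (hΦ : SolvesODE p W Φ) {l : ℂ} (hl : l ≠ 0) {U : Set ℂ}
    (hU : IsOpen U) {s : ℂ → X} (hs : IsSection p s U) {z : ℂ} (hz : z ∈ U) (i j : Fin 2) :
    HasDerivAt (fun w => Φ (s w) l i j) ((Φ (s z) l * potential W z l) i j) z := by
  obtain ⟨e, hxe, he, hd⟩ := hΦ l hl (s z)
  have h := hd i j
  rw [hs.proj z hz] at h
  refine h.congr_of_eventuallyEq ?_
  have hc : ContinuousAt s z := hs.continuousOn.continuousAt (hU.mem_nhds hz)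
  filter_upwards [hc (e.open_source.mem_nhds hxe), hU.mem_nhds hz] with w hw hwU
  have : e (s w) = w := by rw [he _ hw, hs.proj w hwU]
  rw [← this, e.left_inv hw, this]

lemma SolvesODE.hasDerivAt_section_zero (hΦ : SolvesODE p W Φ) {l : ℂ} (hl : l ≠ 0) {U : Set ℂ}
    (hU : IsOpen U) {s : ℂ → X} (hs : IsSection p s U) {z : ℂ} (hz : z ∈ U) (i : Fin 2) :
    HasDerivAt (fun w => Φ (s w) l i 0)
      (Φ (s z) l i 1 * ((l - 1) ^ 2 * quadDiff W z)) z := by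
  have := hΦ.hasDerivAt_section hl hU hs hz i 0
  simpa [mul_apply, Fin.sum_univ_two, potential] using this

lemma SolvesODE.hasDerivAt_section_one (hΦ : SolvesODE p W Φ) {l : ℂ} (hl : l ≠ 0) {U : Set ℂ}
    (hU : IsOpen U) {s : ℂ → X} (hs : IsSection p s U) {z : ℂ} (hz : z ∈ U) (i : Fin 2) :
    HasDerivAt (fun w => Φ (s w) l i 1) (Φ (s z) l i 0 * l⁻¹) z := by
  have := hΦ.hasDerivAt_section hl hU hs hz i 1
  simpa [mul_apply, Fin.sum_univ_two, potential] using this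

/-- The Wronskian of two rows of solutions is constant, as the potential is trace free. -/
lemma SolvesODE.wronskian_eq (hΦ : SolvesODE p W Φ) {l : ℂ} (hl : l ≠ 0) {U : Set ℂ}
    (hU : IsOpen U) (hc : IsPreconnected U) {s s' : ℂ → X} (hs : IsSection p s U)
    (hs' : IsSection p s' U) (i j : Fin 2) {z w : ℂ} (hz : z ∈ U) (hw : w ∈ U) :
    Φ (s z) l i 0 * Φ (s' z) l j 1 - Φ (s z) l i 1 * Φ (s' z) l j 0 =
      Φ (s w) l i 0 * Φ (s' w) l j 1 - Φ (s w) l i 1 * Φ (s' w) l j 0 := by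
  have hd : ∀ z ∈ U, HasDerivAt
      (fun z => Φ (s z) l i 0 * Φ (s' z) l j 1 - Φ (s z) l i 1 * Φ (s' z) l j 0) 0 z := by
    intro z hz
    have h := ((hΦ.hasDerivAt_section_zero hl hU hs hz i).fun_mul
      (hΦ.hasDerivAt_section_one hl hU hs' hz j)).fun_sub
      ((hΦ.hasDerivAt_section_one hl hU hs hz i).fun_mul
      (hΦ.hasDerivAt_section_zero hl hU hs' hz j))
    exact h.congr_deriv (by ring)
  exact hU.is_const_of_deriv_eq_zero hc
    (fun z hz => (hd z hz).differentiableAt.differentiableWithinAt)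
    (fun z hz => (hd z hz).deriv) hz hw

lemma SolvesODE.mul_adjugate_eq (hΦ : SolvesODE p W Φ) {l : ℂ} (hl : l ≠ 0) {U : Set ℂ}
    (hU : IsOpen U) (hc : IsPreconnected U) {s s' : ℂ → X} (hs : IsSection p s U)
    (hs' : IsSection p s' U) {z w : ℂ} (hz : z ∈ U) (hw : w ∈ U) :
    Φ (s' z) l * (Φ (s z) l).adjugate = Φ (s' w) l * (Φ (s w) l).adjugate := by
  have h := fun i j => hΦ.wronskian_eq hl hU hc hs' hs i j hz hw
  ext i j
  fin_cases j <;> simp only [adjugate_fin_two, mul_apply, Fin.sum_univ_two] <;> simp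
  · linear_combination h i 1
  · linear_combination -h i 0

lemma SolvesODE.det_eq (hΦ : SolvesODE p W Φ) (hp : IsUniversalCover p) {l : ℂ} (hl : l ≠ 0)
    (x y : X) : (Φ x l).det = (Φ y l).det := by
  have := hp.simplyConnected
  have h : IsLocallyConstant fun x => (Φ x l).det := by
    rw [IsLocallyConstant.iff_eventually_eq]
    intro y
    obtain ⟨ε, σ, hε, -, hσ, hev⟩ := hp.exists_local_section y univ_mem
    filter_upwards [hev] with y' hy'
    have h := hΦ.wronskian_eq hl Metric.isOpen_ball (convex_ball _ _).isPreconnected hσ hσ 0 1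
      hy'.1 (Metric.mem_ball_self hε)
    rw [hy'.2, hev.self_of_nhds.2] at h
    rw [det_fin_two, det_fin_two]
    exact h
  exact h.apply_eq_of_preconnectedSpace x y

lemma SolvesODE.isFlat (hΦ : SolvesODE p W Φ) (hp : IsUniversalCover p) {l : ℂ} (hl : l ≠ 0)
    (h : ∀ x, (Φ x l).det ≠ 0) : IsFlat p (solutionGL Φ l h) := by
  intro U s s' hU hc hs hs' z hz w hw
  apply Units.ext
  simp only [Units.val_mul, coe_units_inv, coe_solutionGL, inv_def,
    hΦ.det_eq hp hl (s z) (s w), Matrix.mul_smul, hΦ.mul_adjugate_eq hl hU hc hs hs' hz hw]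

end Solutions

/-! ### Transport along half circles -/

section Transport

attribute [local instance] Matrix.linftyOpNormedRing Matrix.linftyOpNormedAlgebra

open NormedSpace in
/-- Solutions of `W' = W * R` whose coefficients converge uniformly to a constant `a` converge to
the exponential. -/
lemma tendsto_exp_of_hasDerivAt {E ι : Type*} [NormedRing E] [NormedAlgebra ℝ E] [CompleteSpace E]
    {F : Filter ι} {a : E} {R V : ι → ℝ → E} {T : ℝ} (hT : 0 ≤ T)
    (hV : ∀ᶠ i in F, V i 0 = 1 ∧ ∀ θ ∈ Set.Icc 0 T, HasDerivAt (V i) (V i θ * R i θ) θ)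
    (hR : ∀ ε > 0, ∀ᶠ i in F, ∀ θ ∈ Set.Icc 0 T, ‖R i θ - a‖ ≤ ε) :
    Tendsto (fun i => V i T) F (𝓝 (exp (T • a))) := by
  have hexp : ∀ θ : ℝ, HasDerivAt (fun θ : ℝ => exp (θ • a)) (exp (θ • a) * a) θ :=
    fun θ => hasDerivAt_exp_smul_const a θ
  have hcont : Continuous fun θ : ℝ => exp (θ • a) :=
    continuous_iff_continuousAt.2 fun θ => (hexp θ).continuousAt
  obtain ⟨C, hC⟩ := isCompact_Icc.exists_bound_of_continuousOn (s := Set.Icc 0 T) hcont.continuousOn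
  have hC0 : 0 ≤ C := (norm_nonneg _).trans (hC 0 ⟨le_rfl, hT⟩)
  set K : NNReal := ‖a‖₊ + 1 with hK
  have key : ∀ ε, 0 < ε → ε ≤ 1 → ∀ᶠ i in F,
      dist (V i T) (exp (T • a)) ≤ gronwallBound 0 K (C * ε) T := by
    intro ε hε hε1
    filter_upwards [hV, hR ε hε] with i hi hRi
    have hlip : ∀ θ ∈ Set.Ico 0 T, LipschitzOnWith K (fun x => x * R i θ) Set.univ := by
      intro θ hθ
      refine LipschitzOnWith.of_dist_le_mul fun x _ y _ => ?_
      rw [dist_eq_norm, dist_eq_norm, ← sub_mul]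
      refine (norm_mul_le _ _).trans ?_
      rw [mul_comm]
      gcongr
      have h1 : ‖R i θ‖ ≤ ‖R i θ - a‖ + ‖a‖ := by
        simpa using norm_add_le (R i θ - a) a
      have h2 := hRi θ (Set.Ico_subset_Icc_self hθ)
      have h3 : (K : ℝ) = ‖a‖ + 1 := by simp [hK]
      linarith
    have := dist_le_of_approx_trajectories_ODE_of_mem (f := V i)
      (g := fun θ : ℝ => exp (θ • a)) (f' := fun θ => V i θ * R i θ)
      (g' := fun θ => exp (θ • a) * a) (εf := 0) (εg := C * ε) (δ := 0) (a := 0) (b := T)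
      hlip (fun θ hθ => (hi.2 θ hθ).continuousAt.continuousWithinAt)
      (fun θ hθ => (hi.2 θ (Set.Ico_subset_Icc_self hθ)).hasDerivWithinAt) (fun θ _ => by simp)
      (fun θ _ => Set.mem_univ _) hcont.continuousOn (fun θ _ => (hexp θ).hasDerivWithinAt)
      (fun θ hθ => by
        rw [dist_eq_norm, ← mul_sub]
        refine (norm_mul_le _ _).trans ?_
        rw [norm_sub_rev]
        exact mul_le_mul (hC θ (Set.Ico_subset_Icc_self hθ))
          (hRi θ (Set.Ico_subset_Icc_self hθ)) (norm_nonneg _) hC0)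
      (fun θ _ => Set.mem_univ _) (by simp [hi.1]) T ⟨hT, le_rfl⟩
    simpa using this
  rw [Metric.tendsto_nhds]
  intro δ hδ
  have hlim : Tendsto (fun ε : ℝ => gronwallBound 0 K (C * ε) T) (𝓝[>] 0) (𝓝 0) := by
    have h1 : Continuous fun ε : ℝ => gronwallBound 0 K (C * ε) T :=
      (gronwallBound_continuous_ε 0 K T).comp (continuous_const.mul continuous_id)
    have h2 := h1.tendsto 0
    simp only [mul_zero, gronwallBound_ε0_δ0] at h2
    exact h2.mono_left nhdsWithin_le_nhds
  obtain ⟨ε, ⟨h1, h2⟩, h3⟩ := (((hlim.eventually_lt_const hδ).and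
    ((eventually_le_nhds one_pos).filter_mono nhdsWithin_le_nhds)).and
      (self_mem_nhdsWithin (s := Set.Ioi (0 : ℝ)))).exists
  filter_upwards [key ε h3 h2] with i hi using hi.trans_lt h1

lemma hasDerivAt_of_entries {f : ℝ → Matrix (Fin 2) (Fin 2) ℂ} {f' : Matrix (Fin 2) (Fin 2) ℂ}
    {θ : ℝ} (h : ∀ i j, HasDerivAt (fun θ => f θ i j) (f' i j) θ) : HasDerivAt f f' θ := by
  have hM : ∀ M : Matrix (Fin 2) (Fin 2) ℂ, M = M 0 0 • !![1, 0; 0, 0] + M 0 1 • !![0, 1; 0, 0] +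
      M 1 0 • !![0, 0; 1, 0] + M 1 1 • !![0, 0; 0, 1] := by
    intro M
    ext i j
    fin_cases i <;> fin_cases j <;> simp
  have hf : f = fun θ => f θ 0 0 • !![1, 0; 0, 0] + f θ 0 1 • !![0, 1; 0, 0] +
      f θ 1 0 • !![0, 0; 1, 0] + f θ 1 1 • !![0, 0; 0, 1] := funext fun θ => hM _
  rw [hf, hM f']
  exact ((((h 0 0).smul_const _).add ((h 0 1).smul_const _)).add ((h 1 0).smul_const _)).add
    ((h 1 1).smul_const _)

/-- The point at angle `θ` on the circle of radius `ρ` around `c`. -/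
def circ (c : ℂ) (ρ θ : ℝ) : ℂ := c + ρ * Complex.exp (θ * Complex.I)

lemma hasDerivAt_circ (c : ℂ) (ρ θ : ℝ) :
    HasDerivAt (circ c ρ) (Complex.I * (circ c ρ θ - c)) θ := by
  have h1 : HasDerivAt (fun θ : ℝ => (θ : ℂ) * Complex.I) (1 * Complex.I) θ :=
    (Complex.ofRealCLM.hasDerivAt (x := θ)).mul_const Complex.I
  have h2 := (h1.cexp.const_mul (ρ : ℂ)).const_add c
  refine HasDerivAt.congr_deriv (f := circ c ρ) h2 ?_
  simp only [circ]
  ring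

lemma circ_zero (c : ℂ) (ρ : ℝ) : circ c ρ 0 = c + ρ := by simp [circ]

lemma circ_pi (c : ℂ) (ρ : ℝ) : circ c ρ Real.pi = c - ρ := by
  simp [circ, Complex.exp_pi_mul_I, sub_eq_add_neg]

lemma circ_two_pi (c : ℂ) (ρ : ℝ) : circ c ρ (2 * Real.pi) = c + ρ := by
  simp [circ, Complex.exp_two_pi_mul_I]

/-- The gauge which turns the row `(a, b)` of a solution into `(b, (z - c) db/dz)`. -/
def gauge (l ζ : ℂ) : Matrix (Fin 2) (Fin 2) ℂ := !![0, ζ / l; 1, 0]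

/-- The coefficient matrix of the gauged equation in the coordinate `log (z - c)`. -/
def gaugedPotential (κ : ℂ) : Matrix (Fin 2) (Fin 2) ℂ := !![0, κ; 1, 1]

lemma hasDerivAt_gauged {Y : ℂ → Matrix (Fin 2) (Fin 2) ℂ} {q : ℂ → ℂ} {l m c : ℂ} {ρ θ : ℝ}
    (h0 : ∀ i, HasDerivAt (fun z => Y z i 0) (Y (circ c ρ θ) i 1 * (m * q (circ c ρ θ)))
      (circ c ρ θ))
    (h1 : ∀ i, HasDerivAt (fun z => Y z i 1) (Y (circ c ρ θ) i 0 * l⁻¹) (circ c ρ θ)) :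
    HasDerivAt (fun θ => Y (circ c ρ θ) * gauge l (circ c ρ θ - c))
      (Y (circ c ρ θ) * gauge l (circ c ρ θ - c) * Complex.I •
        gaugedPotential (m / l * (circ c ρ θ - c) ^ 2 * q (circ c ρ θ))) θ := by
  apply hasDerivAt_of_entries
  have hz := hasDerivAt_circ c ρ θ
  intro i j
  have k0 := (h0 i).comp θ hz
  have k1 := (h1 i).comp θ hz
  fin_cases j
  · simp [mul_apply, Fin.sum_univ_two, gauge, gaugedPotential]
    exact k1.congr_deriv (by ring)
  · simp [mul_apply, Fin.sum_univ_two, gauge, gaugedPotential]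
    refine (k0.fun_mul ((hz.sub_const c).div_const l)).congr_deriv ?_
    simp only [Function.comp]
    ring

/-- The trace of a monodromy around a regular singular point. The transports over the two halves
of a circle around the puncture converge, in the gauged frame, to the exponential of half a turn. -/
lemma trace_loop_eq {Y₁ Y₂ : ℂ → Matrix (Fin 2) (Fin 2) ℂ} {q : ℂ → ℂ} {l m c κ₀ : ℂ} (hl : l ≠ 0)
    {F : Filter ℝ} [F.NeBot] {T₁ T₂ : Matrix (Fin 2) (Fin 2) ℂ} (hT : T₁.det ≠ 0)
    (hρ : ∀ᶠ ρ in F, ρ ≠ 0)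
    (h₁ : ∀ᶠ ρ in F, ∀ θ ∈ Set.Icc 0 Real.pi, (Y₁ (circ c ρ θ)).det ≠ 0 ∧ ∀ i,
      HasDerivAt (fun z => Y₁ z i 0) (Y₁ (circ c ρ θ) i 1 * (m * q (circ c ρ θ))) (circ c ρ θ) ∧
      HasDerivAt (fun z => Y₁ z i 1) (Y₁ (circ c ρ θ) i 0 * l⁻¹) (circ c ρ θ))
    (h₂ : ∀ᶠ ρ in F, ∀ θ ∈ Set.Icc Real.pi (2 * Real.pi), ∀ i,
      HasDerivAt (fun z => Y₂ z i 0) (Y₂ (circ c ρ θ) i 1 * (m * q (circ c ρ θ))) (circ c ρ θ) ∧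
      HasDerivAt (fun z => Y₂ z i 1) (Y₂ (circ c ρ θ) i 0 * l⁻¹) (circ c ρ θ))
    (hT₁ : ∀ᶠ ρ : ℝ in F, Y₂ (c - ρ) = T₁ * Y₁ (c - ρ))
    (hT₂ : ∀ᶠ ρ : ℝ in F, Y₂ (c + ρ) = T₂ * Y₁ (c + ρ))
    (hκ : ∀ ε > 0, ∀ᶠ ρ in F, ∀ θ,
      ‖m / l * (circ c ρ θ - c) ^ 2 * q (circ c ρ θ) - κ₀‖ ≤ ε) :
    (T₁⁻¹ * T₂).trace =
      (NormedSpace.exp ((2 * Real.pi) • (Complex.I • gaugedPotential κ₀))).trace := by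
  set κ : ℂ → ℂ := fun z => m / l * (z - c) ^ 2 * q z with hκd
  set a := Complex.I • gaugedPotential κ₀ with ha
  let V₁ : ℝ → ℝ → Matrix (Fin 2) (Fin 2) ℂ := fun ρ θ =>
    Y₁ (circ c ρ θ) * gauge l (circ c ρ θ - c)
  let V₂ : ℝ → ℝ → Matrix (Fin 2) (Fin 2) ℂ := fun ρ θ =>
    Y₂ (circ c ρ θ) * gauge l (circ c ρ θ - c)
  let R : ℝ → ℝ → Matrix (Fin 2) (Fin 2) ℂ := fun ρ θ =>
    Complex.I • gaugedPotential (κ (circ c ρ θ))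
  have hR : ∀ ε > 0, ∀ᶠ ρ in F, ∀ θ, ‖R ρ θ - a‖ ≤ ε := by
    intro ε hε
    set E : Matrix (Fin 2) (Fin 2) ℂ := !![0, 1; 0, 0] with hE
    have h := hκ (ε / (‖E‖ + 1)) (by positivity)
    filter_upwards [h] with ρ hρ θ
    have : R ρ θ - a = (Complex.I * (κ (circ c ρ θ) - κ₀)) • E := by
      ext i j
      fin_cases i <;> fin_cases j <;> simp [R, ha, gaugedPotential, hE, mul_sub]
    rw [this, norm_smul, norm_mul, Complex.norm_I, one_mul]
    calc _ ≤ ε / (‖E‖ + 1) * (‖E‖ + 1) :=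
          mul_le_mul (hρ θ) (by linarith) (norm_nonneg _) (by positivity)
      _ = ε := by field_simp
  have hdetg : ∀ ρ θ : ℝ, ρ ≠ 0 → (gauge l (circ c ρ θ - c)).det ≠ 0 := by
    intro ρ θ h
    simp [gauge, det_fin_two_of, circ, h, hl]
  have hpi := Real.pi_pos
  have lim₁ : Tendsto (fun ρ => (V₁ ρ 0)⁻¹ * V₁ ρ Real.pi) F
      (𝓝 (NormedSpace.exp (Real.pi • a))) := by
    refine tendsto_exp_of_hasDerivAt (R := R) (V := fun ρ θ => (V₁ ρ 0)⁻¹ * V₁ ρ θ) hpi.le ?_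
      (fun ε hε => (hR ε hε).mono fun ρ h θ _ => h θ)
    filter_upwards [h₁, hρ] with ρ h hρ'
    have hdet : (V₁ ρ 0).det ≠ 0 := by
      simp only [V₁, det_mul]
      exact mul_ne_zero (h 0 ⟨le_rfl, hpi.le⟩).1 (hdetg ρ 0 hρ')
    refine ⟨nonsing_inv_mul _ (isUnit_iff_ne_zero.2 hdet), fun θ hθ => ?_⟩
    have := (hasDerivAt_gauged (fun i => ((h θ hθ).2 i).1) (fun i => ((h θ hθ).2 i).2)).const_mul
      (V₁ ρ 0)⁻¹
    rwa [← mul_assoc] at this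
  have hsplit : ∀ᶠ ρ in F, V₂ ρ Real.pi = T₁ * V₁ ρ Real.pi ∧
      V₂ ρ (2 * Real.pi) = T₂ * V₁ ρ 0 := by
    filter_upwards [hT₁, hT₂] with ρ k1 k2
    simp only [V₁, V₂, circ_zero, circ_pi, circ_two_pi, k1, k2, mul_assoc, and_self]
  have lim₂ : Tendsto (fun ρ => (V₂ ρ Real.pi)⁻¹ * V₂ ρ (2 * Real.pi)) F
      (𝓝 (NormedSpace.exp (Real.pi • a))) := by
    have := tendsto_exp_of_hasDerivAt (F := F) (a := a) (R := fun ρ θ => R ρ (Real.pi + θ))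
      (V := fun ρ θ => (V₂ ρ Real.pi)⁻¹ * V₂ ρ (Real.pi + θ)) hpi.le ?_
      (fun ε hε => (hR ε hε).mono fun ρ h θ _ => h _)
    · rw [two_mul]
      exact this
    filter_upwards [h₁, h₂, hsplit, hρ] with ρ h h' hs hρ'
    have hdet : (V₂ ρ Real.pi).det ≠ 0 := by
      rw [hs.1, det_mul]
      simp only [V₁, det_mul]
      exact mul_ne_zero hT (mul_ne_zero (h Real.pi ⟨hpi.le, le_rfl⟩).1 (hdetg ρ Real.pi hρ'))
    refine ⟨by simpa using nonsing_inv_mul _ (isUnit_iff_ne_zero.2 hdet), fun θ hθ => ?_⟩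
    have hθ' : Real.pi + θ ∈ Set.Icc Real.pi (2 * Real.pi) :=
      ⟨by linarith [hθ.1], by linarith [hθ.2]⟩
    have h2 := (hasDerivAt_gauged (fun i => (h' _ hθ' i).1) (fun i => (h' _ hθ' i).2)).const_mul
      (V₂ ρ Real.pi)⁻¹
    rw [← mul_assoc] at h2
    exact h2.comp_const_add Real.pi θ
  have hcont : Continuous fun M : Matrix (Fin 2) (Fin 2) ℂ => M.trace := continuous_id.matrix_trace
  have lim := (hcont.tendsto _).comp (lim₁.mul lim₂)
  have hexp : NormedSpace.exp (Real.pi • a) * NormedSpace.exp (Real.pi • a) =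
      NormedSpace.exp ((2 * Real.pi) • a) := by
    rw [← Matrix.exp_add_of_commute _ _ (Commute.refl _), ← add_smul, two_mul]
  rw [hexp] at lim
  refine tendsto_nhds_unique (tendsto_const_nhds.congr' ?_) lim
  filter_upwards [h₁, hsplit, hρ] with ρ h hs hρ'
  have hdet0 : IsUnit (V₁ ρ 0).det := by
    simp only [V₁, det_mul]
    exact isUnit_iff_ne_zero.2 (mul_ne_zero (h 0 ⟨le_rfl, hpi.le⟩).1 (hdetg ρ 0 hρ'))
  have hdetp : IsUnit (V₁ ρ Real.pi).det := by
    simp only [V₁, det_mul]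
    exact isUnit_iff_ne_zero.2
      (mul_ne_zero (h Real.pi ⟨hpi.le, le_rfl⟩).1 (hdetg ρ Real.pi hρ'))
  simp only [Function.comp]
  rw [hs.1, hs.2, Matrix.mul_inv_rev T₁ (V₁ ρ Real.pi)]
  calc (T₁⁻¹ * T₂).trace = (T₁⁻¹ * T₂ * (V₁ ρ 0 * (V₁ ρ 0)⁻¹)).trace := by
        rw [mul_nonsing_inv _ hdet0, mul_one]
    _ = ((V₁ ρ 0)⁻¹ * (T₁⁻¹ * T₂ * V₁ ρ 0)).trace := by rw [← mul_assoc, trace_mul_comm]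
    _ = ((V₁ ρ 0)⁻¹ * (V₁ ρ Real.pi * (V₁ ρ Real.pi)⁻¹) * (T₁⁻¹ * T₂ * V₁ ρ 0)).trace := by
        rw [mul_nonsing_inv _ hdetp, mul_one]
    _ = _ := by simp only [mul_assoc]

/-- The exponents of the gauged potential at a puncture are `ν` and `1 - ν`. -/
lemma trace_exp_gaugedPotential {ν : ℝ} (hν : ν < 1 / 2) :
    (NormedSpace.exp ((2 * Real.pi) • (Complex.I •
      gaugedPotential (-(ν * (1 - ν)))))).trace = 2 * Real.cos (2 * Real.pi * ν) := by
  set P : Matrix (Fin 2) (Fin 2) ℂ := !![ν - 1, -ν; 1, 1] with hP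
  have hdet : P.det ≠ 0 := by
    rw [hP, det_fin_two_of]
    intro h
    have : (2 * ν - 1 : ℝ) = 0 := by
      have : ((2 * ν - 1 : ℝ) : ℂ) = 0 := by push_cast; linear_combination h
      exact_mod_cast this
    linarith
  have hU : IsUnit P.det := isUnit_iff_ne_zero.2 hdet
  set v : Fin 2 → ℂ := ![2 * Real.pi * Complex.I * ν, 2 * Real.pi * Complex.I * (1 - ν)] with hv
  have h : (2 * Real.pi) • (Complex.I • gaugedPotential (-(ν * (1 - ν)))) =
      P * diagonal v * P⁻¹ := by
    have h1 : (2 * Real.pi) • (Complex.I • gaugedPotential (-(ν * (1 - ν)))) * P =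
        P * diagonal v := by
      ext i j
      fin_cases i <;> fin_cases j <;>
        simp [hP, hv, gaugedPotential, mul_apply, Fin.sum_univ_two, diagonal] <;> ring
    rw [← h1, mul_assoc, mul_nonsing_inv _ hU, mul_one]
  rw [h, Matrix.exp_conj _ _ ((isUnit_iff_isUnit_det _).2 hU), trace_mul_comm, ← mul_assoc,
    nonsing_inv_mul _ hU, one_mul, Matrix.exp_diagonal, trace_diagonal, Fin.sum_univ_two]
  simp only [Pi.coe_exp, hv, cons_val_zero, cons_val_one, ← Complex.exp_eq_exp_ℂ]
  rw [Complex.ofReal_cos, Complex.two_cos]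
  push_cast
  rw [mul_sub, mul_one, sub_eq_add_neg, Complex.exp_add, Complex.exp_two_pi_mul_I, one_mul]
  congr 2 <;> ring

end Transport

/-! ### The local traces -/

section Residues

variable (W : Fin 3 → ℝ) (k : ℂ)

lemma tendsto_quadDiff_zero :
    Tendsto (fun z => k * (z - 0) ^ 2 * quadDiff W z) (𝓝[≠] 0) (𝓝 (k * (W 0 / 16))) := by
  have h : ContinuousAt (fun z : ℂ => k * (((W 2 : ℂ) * z ^ 2 -
      ((W 0 : ℂ) - (W 1 : ℂ) + (W 2 : ℂ)) * z + (W 0 : ℂ)) / (16 * (z - 1) ^ 2))) 0 :=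
    continuousAt_const.mul (ContinuousAt.div (by fun_prop) (by fun_prop) (by simp))
  have h' := h.tendsto.mono_left (nhdsWithin_le_nhds (s := {0}ᶜ))
  simp only [mul_zero, ne_eq, OfNat.ofNat_ne_zero, not_false_eq_true, zero_pow, sub_zero, zero_add,
    zero_sub, even_two, Even.neg_pow, one_pow, mul_one] at h'
  refine h'.congr' ?_
  filter_upwards [self_mem_nhdsWithin] with z hz
  have hz : z ≠ 0 := hz
  simp only [quadDiff]
  field_simp
  ring

lemma tendsto_quadDiff_one :
    Tendsto (fun z => k * (z - 1) ^ 2 * quadDiff W z) (𝓝[≠] 1) (𝓝 (k * (W 1 / 16))) := by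
  have h : ContinuousAt (fun z : ℂ => k * (((W 2 : ℂ) * z ^ 2 -
      ((W 0 : ℂ) - (W 1 : ℂ) + (W 2 : ℂ)) * z + (W 0 : ℂ)) / (16 * z ^ 2))) 1 :=
    continuousAt_const.mul (ContinuousAt.div (by fun_prop) (by fun_prop) (by simp))
  have h' := h.tendsto.mono_left (nhdsWithin_le_nhds (s := {1}ᶜ))
  have e : (W 2 : ℂ) * 1 ^ 2 - ((W 0 : ℂ) - (W 1 : ℂ) + (W 2 : ℂ)) * 1 + (W 0 : ℂ) = W 1 := by ring
  rw [e, one_pow, mul_one] at h'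
  refine h'.congr' ?_
  filter_upwards [self_mem_nhdsWithin] with z hz
  have hz : z - 1 ≠ 0 := sub_ne_zero.2 hz
  simp only [quadDiff]
  field_simp

lemma tendsto_quadDiff_cobounded :
    Tendsto (fun z => k * (z - 0) ^ 2 * quadDiff W z) (Bornology.cobounded ℂ)
      (𝓝 (k * (W 2 / 16))) := by
  have h : ContinuousAt (fun u : ℂ => k * (((W 2 : ℂ) -
      ((W 0 : ℂ) - (W 1 : ℂ) + (W 2 : ℂ)) * u + (W 0 : ℂ) * u ^ 2) / (16 * (1 - u) ^ 2))) 0 :=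
    continuousAt_const.mul (ContinuousAt.div (by fun_prop) (by fun_prop) (by simp))
  have h' := h.tendsto.comp (tendsto_inv₀_cobounded (α := ℂ))
  simp only [mul_zero, sub_zero, ne_eq, OfNat.ofNat_ne_zero, not_false_eq_true, zero_pow, add_zero,
    one_pow, mul_one] at h'
  refine h'.congr' ?_
  filter_upwards [Bornology.eventually_ne_cobounded (0 : ℂ),
    Bornology.eventually_ne_cobounded (1 : ℂ)] with z hz hz1
  have hz1 : z - 1 ≠ 0 := sub_ne_zero.2 hz1
  simp only [quadDiff, Function.comp]
  have e : (1 : ℂ) - z⁻¹ = (z - 1) / z := by field_simp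
  rw [e]
  field_simp
  ring

end Residues

lemma norm_circ_sub (c : ℂ) (ρ θ : ℝ) : ‖circ c ρ θ - c‖ = |ρ| := by
  simp [circ, Complex.norm_exp_ofReal_mul_I]

lemma eventually_circ_of_tendsto {f : ℂ → ℂ} {c κ : ℂ} (h : Tendsto f (𝓝[≠] c) (𝓝 κ)) {ε : ℝ}
    (hε : 0 < ε) : ∀ᶠ ρ in 𝓝[>] (0 : ℝ), ∀ θ, ‖f (circ c ρ θ) - κ‖ ≤ ε := by
  obtain ⟨δ, hδ, hf⟩ := Metric.tendsto_nhdsWithin_nhds.1 h ε hε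
  filter_upwards [Ioo_mem_nhdsGT hδ] with ρ hρ θ
  have hn : ‖circ c ρ θ - c‖ = ρ := by rw [norm_circ_sub, abs_of_pos hρ.1]
  rw [← dist_eq_norm]
  refine (hf ?_ (by rw [dist_eq_norm, hn]; exact hρ.2)).le
  intro h0
  rw [h0, sub_self, norm_zero] at hn
  exact hρ.1.ne hn

lemma eventually_circ_of_tendsto_cobounded {f : ℂ → ℂ} {κ : ℂ}
    (h : Tendsto f (Bornology.cobounded ℂ) (𝓝 κ)) {ε : ℝ} (hε : 0 < ε) :
    ∀ᶠ ρ in (atTop : Filter ℝ), ∀ θ, ‖f (circ 0 ρ θ) - κ‖ ≤ ε := by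
  obtain ⟨R, -, hf⟩ := (hasBasis_cobounded_norm.tendsto_iff Metric.nhds_basis_closedBall).1 h ε hε
  filter_upwards [eventually_ge_atTop (max R 0)] with ρ hρ θ
  rw [← dist_eq_norm]
  apply hf
  have := norm_circ_sub 0 ρ θ
  rw [sub_zero, abs_of_nonneg ((le_max_right _ _).trans hρ)] at this
  exact (((le_max_left _ _).trans hρ).trans this.ge)

section Monodromy

variable {X : Type*} [TopologicalSpace X] {p : X → Base} {W : Fin 3 → ℝ}
  {Φ : X → ℂ → Matrix (Fin 2) (Fin 2) ℂ} {s₁ s₂ : ℂ → X} {l : ℂ}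

/-- The trace of a local monodromy. A half circle in each slit plane makes up a circle around `c`,
and `F` is the filter along which its radius tends to `0`, or to `∞` when the puncture is `∞`. The
two branches are related by `T₁` on the left and by `T₂` on the right of `c`; the number `ν` is the
smaller exponent at the puncture. -/
lemma SolvesODE.trace_eq (hΦ : SolvesODE p W Φ) (hs : SectionPair p s₁ s₂) (hl : l ≠ 0)
    (hdet : ∀ x, (Φ x l).det ≠ 0) {ν : ℝ} (hν : ν < 1 / 2) {c : ℂ} (hc : c.im = 0) {F : Filter ℝ}
    [F.NeBot] {T₁ T₂ : Matrix (Fin 2) (Fin 2) ℂ} (hT : T₁.det ≠ 0)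
    (hρ : ∀ᶠ ρ : ℝ in F, 0 < ρ ∧ ∀ θ, circ c ρ θ ≠ 0 ∧ circ c ρ θ ≠ 1)
    (hT₁ : ∀ᶠ ρ : ℝ in F, Φ (s₂ (c - ρ)) l = T₁ * Φ (s₁ (c - ρ)) l)
    (hT₂ : ∀ᶠ ρ : ℝ in F, Φ (s₂ (c + ρ)) l = T₂ * Φ (s₁ (c + ρ)) l)
    (hκ : ∀ ε > 0, ∀ᶠ ρ in F, ∀ θ, ‖(l - 1) ^ 2 / l * (circ c ρ θ - c) ^ 2 *
      quadDiff W (circ c ρ θ) - (-(ν * (1 - ν)) : ℂ)‖ ≤ ε) :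
    (T₁⁻¹ * T₂).trace = 2 * Real.cos (2 * Real.pi * ν) := by
  rw [← trace_exp_gaugedPotential hν]
  have him : ∀ ρ θ : ℝ, (circ c ρ θ).im = ρ * Real.sin θ := fun ρ θ => by
    simp [circ, hc, Complex.exp_ofReal_mul_I_im]
  refine trace_loop_eq (Y₁ := fun z => Φ (s₁ z) l) (Y₂ := fun z => Φ (s₂ z) l) (F := F) hl hT
    (hρ.mono fun ρ h => h.1.ne') ?_ ?_ hT₁ hT₂ hκ
  · filter_upwards [hρ] with ρ h θ hθ
    have hmem : circ c ρ θ ∈ slitDomain Complex.I := mem_slitDomain_I_of_im_nonneg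
      (by rw [him]; exact mul_nonneg h.1.le (Real.sin_nonneg_of_nonneg_of_le_pi hθ.1 hθ.2)) (h.2 θ)
    exact ⟨hdet _, fun i => ⟨hΦ.hasDerivAt_section_zero hl (isOpen_slitDomain _) hs.upper hmem i,
      hΦ.hasDerivAt_section_one hl (isOpen_slitDomain _) hs.upper hmem i⟩⟩
  · filter_upwards [hρ] with ρ h θ hθ
    have hsin : Real.sin θ ≤ 0 := by
      have := Real.sin_nonneg_of_nonneg_of_le_pi (x := θ - Real.pi) (by linarith [hθ.1])
        (by linarith [hθ.2])
      rw [Real.sin_sub_pi] at this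
      linarith
    have hmem : circ c ρ θ ∈ slitDomain (-Complex.I) := mem_slitDomain_neg_I_of_im_nonpos
      (by rw [him]; exact mul_nonpos_of_nonneg_of_nonpos h.1.le hsin) (h.2 θ)
    exact fun i => ⟨hΦ.hasDerivAt_section_zero hl (isOpen_slitDomain _) hs.lower hmem i,
      hΦ.hasDerivAt_section_one hl (isOpen_slitDomain _) hs.lower hmem i⟩

/-- The indicial equation at a puncture of weight `w`. -/
lemma indicial_eq {t w : ℝ} (h : t * w < 1) {k : ℂ} (hk : k = -4 * t) :
    k * (w / 16) = (-(neck (t * w) * (1 - neck (t * w))) : ℂ) := by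
  have h1 := four_mul_neck_mul h.le
  have h2 : (4 : ℂ) * neck (t * w) * (1 - neck (t * w)) = t * w := by exact_mod_cast h1
  rw [hk]
  linear_combination (1 / 4 : ℂ) * h2

section

variable (hΦ : SolvesODE p W Φ) (hp : IsUniversalCover p) (hs : SectionPair p s₁ s₂) (hl : l ≠ 0)
  (hdet : ∀ x, (Φ x l).det ≠ 0) {t : ℝ} (ht : (l - 1) ^ 2 / l = -4 * t)
  (hW : ∀ k, t * W k < 1)

include hΦ hp hs hl hdet

lemma SolvesODE.branch_left {x : ℝ} (hx : x < 0) :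
    Φ (s₂ x) l = ((solutionGL Φ l hdet (s₂ (-1)) * (solutionGL Φ l hdet (s₁ (-1)))⁻¹ :
      GL (Fin 2) ℂ) : Matrix (Fin 2) (Fin 2) ℂ) * Φ (s₁ x) l := by
  rw [← (hΦ.isFlat hp hl hdet).transition_left hs hx, ← coe_solutionGL hdet, ← coe_solutionGL hdet,
    ← Units.val_mul, inv_mul_cancel_right]

lemma SolvesODE.branch_middle {x : ℝ} (hx : 0 < x) (hx1 : x < 1) :
    Φ (s₂ x) l = 1 * Φ (s₁ x) l := by
  have h := (hΦ.isFlat hp hl hdet).transition_middle hs hx hx1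
  rw [mul_inv_eq_one] at h
  rw [one_mul, ← coe_solutionGL hdet, ← coe_solutionGL hdet, h]

lemma SolvesODE.branch_right {x : ℝ} (hx : 1 < x) :
    Φ (s₂ x) l = ((solutionGL Φ l hdet (s₂ 2) * (solutionGL Φ l hdet (s₁ 2))⁻¹ :
      GL (Fin 2) ℂ) : Matrix (Fin 2) (Fin 2) ℂ) * Φ (s₁ x) l := by
  rw [← (hΦ.isFlat hp hl hdet).transition_right hs hx, ← coe_solutionGL hdet,
    ← coe_solutionGL hdet, ← Units.val_mul, inv_mul_cancel_right]

include ht hW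

/-- The monodromy around `0`, up to orientation: the branches differ over `(-∞, 0)` and agree over
`(0, 1)`. -/
lemma SolvesODE.trace_zero :
    (((solutionGL Φ l hdet (s₂ (-1)) * (solutionGL Φ l hdet (s₁ (-1)))⁻¹)⁻¹ : GL (Fin 2) ℂ) :
      Matrix (Fin 2) (Fin 2) ℂ).trace = 2 * Real.cos (2 * Real.pi * neck (t * W 0)) := by
  have hev : ∀ᶠ ρ : ℝ in 𝓝[>] 0, 0 < ρ ∧ ρ < 1 := Ioo_mem_nhdsGT one_pos
  have := hΦ.trace_eq hs hl hdet (neck_lt_half (hW 0)) (c := 0) (F := 𝓝[>] 0)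
    (T₁ := (solutionGL Φ l hdet (s₂ (-1)) * (solutionGL Φ l hdet (s₁ (-1)))⁻¹ : GL (Fin 2) ℂ))
    (T₂ := 1) rfl ((isUnit_iff_isUnit_det _).1 (Units.isUnit _)).ne_zero ?_ ?_ ?_ ?_
  · rwa [mul_one, ← coe_units_inv] at this
  · filter_upwards [hev] with ρ hρ
    refine ⟨hρ.1, fun θ => ?_⟩
    have hn := norm_circ_sub 0 ρ θ
    rw [sub_zero, abs_of_pos hρ.1] at hn
    constructor <;> intro h <;> rw [h] at hn <;> simp at hn <;> linarith [hρ.1, hρ.2]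
  · filter_upwards [hev] with ρ hρ
    simpa using hΦ.branch_left hp hs hl hdet (x := -ρ) (by linarith [hρ.1])
  · filter_upwards [hev] with ρ hρ
    rw [zero_add]
    exact hΦ.branch_middle hp hs hl hdet hρ.1 hρ.2
  · intro ε hε
    rw [← indicial_eq (hW 0) ht]
    exact eventually_circ_of_tendsto (tendsto_quadDiff_zero W _) hε

/-- The monodromy around `1`: the branches agree over `(0, 1)` and differ over `(1, ∞)`. -/
lemma SolvesODE.trace_one :
    ((solutionGL Φ l hdet (s₂ 2) * (solutionGL Φ l hdet (s₁ 2))⁻¹ : GL (Fin 2) ℂ) :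
      Matrix (Fin 2) (Fin 2) ℂ).trace = 2 * Real.cos (2 * Real.pi * neck (t * W 1)) := by
  have hev : ∀ᶠ ρ : ℝ in 𝓝[>] 0, 0 < ρ ∧ ρ < 1 := Ioo_mem_nhdsGT one_pos
  have := hΦ.trace_eq hs hl hdet (neck_lt_half (hW 1)) (c := 1) (F := 𝓝[>] 0)
    (T₁ := 1) (T₂ := (solutionGL Φ l hdet (s₂ 2) * (solutionGL Φ l hdet (s₁ 2))⁻¹ : GL (Fin 2) ℂ))
    rfl (by simp) ?_ ?_ ?_ ?_
  · rwa [inv_one, one_mul] at this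
  · filter_upwards [hev] with ρ hρ
    refine ⟨hρ.1, fun θ => ?_⟩
    have hn := norm_circ_sub 1 ρ θ
    rw [abs_of_pos hρ.1] at hn
    constructor <;> intro h <;> rw [h] at hn <;> simp at hn <;> linarith [hρ.1, hρ.2]
  · filter_upwards [hev] with ρ hρ
    simpa using hΦ.branch_middle hp hs hl hdet (x := 1 - ρ) (by linarith [hρ.2])
      (by linarith [hρ.1])
  · filter_upwards [hev] with ρ hρ
    simpa using hΦ.branch_right hp hs hl hdet (x := 1 + ρ) (by linarith [hρ.1])
  · intro ε hε
    rw [← indicial_eq (hW 1) ht]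
    exact eventually_circ_of_tendsto (tendsto_quadDiff_one W _) hε

/-- The monodromy around `∞`: the branches differ over both `(-∞, 0)` and `(1, ∞)`. -/
lemma SolvesODE.trace_infty :
    ((((solutionGL Φ l hdet (s₂ (-1)) * (solutionGL Φ l hdet (s₁ (-1)))⁻¹)⁻¹ : GL (Fin 2) ℂ) :
        Matrix (Fin 2) (Fin 2) ℂ) *
      ((solutionGL Φ l hdet (s₂ 2) * (solutionGL Φ l hdet (s₁ 2))⁻¹ : GL (Fin 2) ℂ) :
        Matrix (Fin 2) (Fin 2) ℂ)).trace = 2 * Real.cos (2 * Real.pi * neck (t * W 2)) := by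
  have hev : ∀ᶠ ρ : ℝ in atTop, 1 < ρ := eventually_gt_atTop 1
  have := hΦ.trace_eq hs hl hdet (neck_lt_half (hW 2)) (c := 0) (F := atTop)
    (T₁ := (solutionGL Φ l hdet (s₂ (-1)) * (solutionGL Φ l hdet (s₁ (-1)))⁻¹ : GL (Fin 2) ℂ))
    (T₂ := (solutionGL Φ l hdet (s₂ 2) * (solutionGL Φ l hdet (s₁ 2))⁻¹ : GL (Fin 2) ℂ))
    rfl ((isUnit_iff_isUnit_det _).1 (Units.isUnit _)).ne_zero ?_ ?_ ?_ ?_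
  · rwa [← coe_units_inv] at this
  · filter_upwards [hev] with ρ hρ
    have hρ0 : 0 < ρ := one_pos.trans hρ
    refine ⟨hρ0, fun θ => ?_⟩
    have hn := norm_circ_sub 0 ρ θ
    rw [sub_zero, abs_of_pos hρ0] at hn
    constructor <;> intro h <;> rw [h] at hn <;> simp at hn <;> linarith
  · filter_upwards [hev] with ρ hρ
    simpa using hΦ.branch_left hp hs hl hdet (x := -ρ) (by linarith)
  · filter_upwards [hev] with ρ hρ
    rw [zero_add]
    exact hΦ.branch_right hp hs hl hdet hρ
  · intro ε hε
    rw [← indicial_eq (hW 2) ht]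
    exact eventually_circ_of_tendsto_cobounded (tendsto_quadDiff_cobounded W _) hε

end

/-! ### Unitarizability at a single loop parameter -/

lemma mem_unitaryGroup_conj_inv {C M : GL (Fin 2) ℂ}
    (h : (C : Matrix (Fin 2) (Fin 2) ℂ) * M * (C⁻¹ : GL (Fin 2) ℂ) ∈ unitaryGroup (Fin 2) ℂ) :
    (C : Matrix (Fin 2) (Fin 2) ℂ) * (M⁻¹ : GL (Fin 2) ℂ) * (C⁻¹ : GL (Fin 2) ℂ) ∈
      unitaryGroup (Fin 2) ℂ := by
  have h1 : (C : Matrix (Fin 2) (Fin 2) ℂ) * (M⁻¹ : GL (Fin 2) ℂ) * (C⁻¹ : GL (Fin 2) ℂ) =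
      star ((C : Matrix (Fin 2) (Fin 2) ℂ) * M * (C⁻¹ : GL (Fin 2) ℂ)) := by
    have h2 := mem_unitaryGroup_iff.1 h
    have h3 : ((C * M⁻¹ * C⁻¹ : GL (Fin 2) ℂ) : Matrix (Fin 2) (Fin 2) ℂ) *
        ((C * M * C⁻¹ : GL (Fin 2) ℂ) : Matrix (Fin 2) (Fin 2) ℂ) = 1 := by
      rw [← Units.val_mul, ← Units.val_one]
      congr 1
      group
    simp only [Units.val_mul] at h3
    exact left_inv_eq_right_inv h3 h2
  rw [h1]
  exact Unitary.star_mem h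

lemma mem_unitaryGroup_conj_of_mem_closure {C A B M : GL (Fin 2) ℂ}
    (hA : (C : Matrix (Fin 2) (Fin 2) ℂ) * A * (C⁻¹ : GL (Fin 2) ℂ) ∈ unitaryGroup (Fin 2) ℂ)
    (hB : (C : Matrix (Fin 2) (Fin 2) ℂ) * B * (C⁻¹ : GL (Fin 2) ℂ) ∈ unitaryGroup (Fin 2) ℂ)
    (hM : M ∈ Subgroup.closure {A, B}) :
    (C : Matrix (Fin 2) (Fin 2) ℂ) * M * (C⁻¹ : GL (Fin 2) ℂ) ∈ unitaryGroup (Fin 2) ℂ := by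
  induction hM using Subgroup.closure_induction with
  | mem x hx =>
    rcases hx with rfl | rfl
    exacts [hA, hB]
  | one => simp
  | mul x y _ _ hx hy =>
    have := mul_mem hx hy
    convert this using 1
    simp only [← Units.val_mul]
    congr 1
    group
  | inv x _ hx => exact mem_unitaryGroup_conj_inv hx

/-- At a loop parameter with `(l - 1)² / l = -4 t`, the monodromy is nondegenerate and
unitarizable exactly when the spectral discriminant is positive. -/
lemma SolvesODE.unitarizable_iff (hΦ : SolvesODE p W Φ) (hp : IsUniversalCover p) (hl : l ≠ 0)
    (hdet : ∀ x, (Φ x l).det ≠ 0) {t : ℝ} (ht : (l - 1) ^ 2 / l = -4 * t)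
    (hW : ∀ k, t * W k < 1) (x : X) :
    (Nondegenerate (monodromy Φ x l '' deck p) ∧
      SimultaneouslyUnitarizable (monodromy Φ x l '' deck p)) ↔ 0 < spectralDiscr W t := by
  obtain ⟨s₁, s₂, hs⟩ := hp.exists_sectionPair
  have hflat := hΦ.isFlat hp hl hdet
  have tr0 := hΦ.trace_zero hp hs hl hdet ht hW
  have tr1 := hΦ.trace_one hp hs hl hdet ht hW
  have tr2 := hΦ.trace_infty hp hs hl hdet ht hW
  have hgen : ∀ τ ∈ deck p, solutionGL Φ l hdet (τ x) * (solutionGL Φ l hdet x)⁻¹ ∈ _ :=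
    fun τ hτ => hflat.monodromy_mem_closure hp hs hτ x
  set g := solutionGL Φ l hdet with hg
  have hmon : ∀ τ : X ≃ₜ X, monodromy Φ x l τ =
      ((g (τ x) * (g x)⁻¹ : GL (Fin 2) ℂ) : Matrix (Fin 2) (Fin 2) ℂ) := fun τ => by
    rw [Units.val_mul, coe_units_inv]
    rfl
  have hdet1 : ∀ y z : X, ((g y * (g z)⁻¹ : GL (Fin 2) ℂ) : Matrix (Fin 2) (Fin 2) ℂ).det = 1 := by
    intro y z
    rw [Units.val_mul, det_mul, coe_units_inv, det_nonsing_inv, hg, coe_solutionGL, coe_solutionGL,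
      hΦ.det_eq hp hl y z]
    exact Ring.mul_inverse_cancel _ (isUnit_iff_ne_zero.2 (hdet z))
  -- two points in the same fibre are related by a deck transformation
  have hmem : ∀ y z : X, (p y : ℂ) = p z →
      ((g y * (g z)⁻¹ : GL (Fin 2) ℂ) : Matrix (Fin 2) (Fin 2) ℂ) ∈ monodromy Φ x l '' deck p := by
    intro y z hyz
    obtain ⟨τ, hτ, rfl⟩ := hp.exists_deck (Subtype.ext hyz.symm)
    exact ⟨τ, hτ, by rw [hmon, hflat.deck_eq hp hτ x z]⟩
  have hleft : (p (s₁ (-1)) : ℂ) = p (s₂ (-1)) := by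
    rw [hs.upper.proj _ (mem_slitDomain_I_of_im_nonneg (by simp) (by norm_num)),
      hs.lower.proj _ (mem_slitDomain_neg_I_of_im_nonpos (by simp) (by norm_num))]
  have hright : (p (s₂ 2) : ℂ) = p (s₁ 2) := by
    rw [hs.upper.proj _ (mem_slitDomain_I_of_im_nonneg (by simp) (by norm_num)),
      hs.lower.proj _ (mem_slitDomain_neg_I_of_im_nonpos (by simp) (by norm_num))]
  have hA1 := hdet1 (s₁ (-1)) (s₂ (-1))
  have hAm := hmem _ _ hleft
  have hB1 := hdet1 (s₂ 2) (s₁ 2)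
  have hBm := hmem _ _ hright
  have hinv : g (s₁ (-1)) * (g (s₂ (-1)))⁻¹ = (g (s₂ (-1)) * (g (s₁ (-1)))⁻¹)⁻¹ := by group
  rw [hinv] at hA1 hAm
  set A := g (s₂ (-1)) * (g (s₁ (-1)))⁻¹ with hA
  set B := g (s₂ 2) * (g (s₁ 2))⁻¹ with hB
  constructor
  · rintro ⟨⟨_, ⟨σ, hσ, rfl⟩, _, ⟨τ, hτ, rfl⟩, hne⟩, C, hC⟩
    have hCC : ((C⁻¹ : GL (Fin 2) ℂ) : Matrix (Fin 2) (Fin 2) ℂ) * C = 1 := by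
      rw [← Units.val_mul, inv_mul_cancel, Units.val_one]
    have hconj_mul : ∀ M N : Matrix (Fin 2) (Fin 2) ℂ,
        ((C : Matrix (Fin 2) (Fin 2) ℂ) * M * (C⁻¹ : GL (Fin 2) ℂ)) *
          ((C : Matrix (Fin 2) (Fin 2) ℂ) * N * (C⁻¹ : GL (Fin 2) ℂ)) =
        (C : Matrix (Fin 2) (Fin 2) ℂ) * (M * N) * (C⁻¹ : GL (Fin 2) ℂ) := by
      intro M N
      calc _ = (C : Matrix (Fin 2) (Fin 2) ℂ) * M *
            (((C⁻¹ : GL (Fin 2) ℂ) : Matrix (Fin 2) (Fin 2) ℂ) * C) * N * (C⁻¹ : GL (Fin 2) ℂ) := by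
              simp only [mul_assoc]
        _ = _ := by rw [hCC, mul_one]; simp only [mul_assoc]
    have hconj_tr : ∀ M : Matrix (Fin 2) (Fin 2) ℂ,
        ((C : Matrix (Fin 2) (Fin 2) ℂ) * M * (C⁻¹ : GL (Fin 2) ℂ)).trace = M.trace := by
      intro M
      rw [trace_mul_comm, ← mul_assoc, hCC, one_mul]
    have hconj_det : ∀ M : Matrix (Fin 2) (Fin 2) ℂ,
        ((C : Matrix (Fin 2) (Fin 2) ℂ) * M * (C⁻¹ : GL (Fin 2) ℂ)).det = M.det := by
      intro M
      rw [det_mul_comm, ← mul_assoc, hCC, one_mul]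
    refine discr_pos_of_mem_unitaryGroup (hC _ hAm) (hC _ hBm) (by rw [hconj_det, hA1])
      (by rw [hconj_det, hB1]) (by rw [hconj_tr, tr0]) (by rw [hconj_tr, tr1])
      (by rw [hconj_mul, hconj_tr, tr2]) ?_
    intro hcomm
    rw [hconj_mul, hconj_mul] at hcomm
    have hAB : A⁻¹ * B = B * A⁻¹ := by
      apply Units.ext
      rw [Units.val_mul, Units.val_mul]
      have h1 := congrArg (fun M => ((C⁻¹ : GL (Fin 2) ℂ) : Matrix (Fin 2) (Fin 2) ℂ) * M * C) hcomm
      simp only [← mul_assoc, hCC, one_mul] at h1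
      simp only [mul_assoc, hCC, mul_one] at h1
      exact h1
    have hAB' : A * B = B * A := (Commute.inv_left_iff.1 hAB : Commute A B)
    -- then the whole monodromy group is commutative
    have hcl : ∀ M ∈ Subgroup.closure {A, B}, ∀ N ∈ Subgroup.closure {A, B}, M * N = N * M := by
      have hc : ∀ a ∈ ({A, B} : Set (GL (Fin 2) ℂ)), ∀ b ∈ ({A, B} : Set (GL (Fin 2) ℂ)),
          a * b = b * a := by
        rintro a (rfl | rfl) b (rfl | rfl)
        exacts [rfl, hAB', hAB'.symm, rfl]
      intro M hM N hN
      exact congrArg Subtype.val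
        ((Subgroup.isMulCommutative_closure hc).is_comm.comm ⟨M, hM⟩ ⟨N, hN⟩)
    apply hne
    rw [hmon, hmon, ← Units.val_mul, ← Units.val_mul, hcl _ (hgen σ hσ) _ (hgen τ hτ)]
  · intro hpos
    obtain ⟨C, hCA, hCB⟩ := exists_unitarizer hA1 hB1 tr0 tr1 tr2 hpos
    refine ⟨⟨_, hAm, _, hBm, fun hcomm => ?_⟩, C, ?_⟩
    · have h := det_commutator_eq_discr hA1 hB1 tr0 tr1 tr2
      rw [hcomm, sub_self, det_zero] at h
      have h' : (0 : ℝ) = 4 * spectralDiscr W t := by exact_mod_cast h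
      linarith
    · rintro _ ⟨τ, hτ, rfl⟩
      rw [hmon]
      have hCA' := mem_unitaryGroup_conj_inv hCA
      rw [inv_inv] at hCA'
      exact mem_unitaryGroup_conj_of_mem_closure hCA' hCB (hgen τ hτ)

end Monodromy

/-! ### The exceptional loop parameters -/

/-- Infinitely many zeros would accumulate on the compact circle, and the identity theorem would
make `f` vanish on the connected set `ℂ \ {0}`. -/
lemma finite_zeros_on_sphere {f : ℂ → ℂ} (hf : DifferentiableOn ℂ f {0}ᶜ) {a : ℂ} (ha : a ≠ 0)
    (hfa : f a ≠ 0) : {l : ℂ | ‖l‖ = 1 ∧ f l = 0}.Finite := by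
  by_contra hinf
  have hsub : {l : ℂ | ‖l‖ = 1 ∧ f l = 0} ⊆ Metric.sphere 0 1 := fun l hl => by
    simpa using hl.1
  obtain ⟨z, hz, hacc⟩ :=
    Set.Infinite.exists_accPt_of_subset_isCompact hinf (isCompact_sphere (0 : ℂ) 1) hsub
  have hz0 : z ∈ ({0}ᶜ : Set ℂ) := by
    rintro rfl
    simp at hz
  have han : AnalyticOnNhd ℂ f {0}ᶜ := hf.analyticOnNhd isOpen_compl_singleton
  have hc : IsPreconnected ({0}ᶜ : Set ℂ) :=
    (isConnected_compl_singleton_of_one_lt_rank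
      (by simp [Complex.rank_real_complex]) 0).isPreconnected
  have hfr : ∃ᶠ w in 𝓝[≠] z, f w = 0 :=
    (accPt_iff_frequently_nhdsNE.1 hacc).mono fun w hw => hw.2
  exact hfa (han.eqOn_zero_of_preconnected_of_frequently_eq_zero hc hz0 hfr ha)

lemma sub_one_sq_div_of_norm_eq_one {l : ℂ} (hl : ‖l‖ = 1) :
    (l - 1) ^ 2 / l = -4 * ((1 - l.re) / 2 : ℝ) := by
  have h0 : l ≠ 0 := by rintro rfl; simp at hl
  have h1 : l * (starRingEnd ℂ) l = 1 := by
    rw [Complex.mul_conj, Complex.normSq_eq_norm_sq, hl]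
    simp
  have h2 : l + (starRingEnd ℂ) l = (2 * l.re : ℝ) := Complex.add_conj l
  rw [div_eq_iff h0]
  push_cast at h2 ⊢
  linear_combination l * h2 - h1

lemma abs_re_le_of_norm_eq_one {l : ℂ} (hl : ‖l‖ = 1) : -1 ≤ l.re ∧ l.re ≤ 1 := by
  have := Complex.abs_re_le_norm l
  rw [hl] at this
  exact abs_le.1 this

lemma re_lt_of_norm_eq_one {l : ℂ} (hl : ‖l‖ = 1) (h1 : l ≠ 1) (h2 : l ≠ -1) :
    -1 < l.re ∧ l.re < 1 := by
  have h := abs_re_le_of_norm_eq_one hl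
  have hn : l.re ^ 2 + l.im ^ 2 = 1 := by
    have := Complex.normSq_eq_norm_sq l
    rw [hl, Complex.normSq_apply] at this
    linarith
  have him : l.re ^ 2 = 1 → l.im = 0 := fun h => by
    have : l.im ^ 2 = 0 := by linarith
    exact pow_eq_zero_iff two_ne_zero |>.1 this
  refine ⟨lt_of_le_of_ne h.1 fun hc => h2 ?_, lt_of_le_of_ne h.2 fun hc => h1 ?_⟩
  · exact Complex.ext (by simp [← hc]) (by simp [him (by rw [← hc]; norm_num)])
  · exact Complex.ext (by simp [hc]) (by simp [him (by rw [hc]; norm_num)])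

lemma exists_norm_eq_one {t : ℝ} (h0 : 0 ≤ t) (h1 : t ≤ 1) :
    ∃ l : ℂ, ‖l‖ = 1 ∧ (1 - l.re) / 2 = t := by
  refine ⟨⟨1 - 2 * t, √(1 - (1 - 2 * t) ^ 2)⟩, ?_, by simp⟩
  have h := Real.sq_sqrt (show 0 ≤ 1 - (1 - 2 * t) ^ 2 by nlinarith)
  have : ‖(⟨1 - 2 * t, √(1 - (1 - 2 * t) ^ 2)⟩ : ℂ)‖ ^ 2 = 1 := by
    rw [← Complex.normSq_eq_norm_sq, Complex.normSq_apply]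
    simp only
    linarith
  exact (pow_eq_one_iff_of_nonneg (norm_nonneg _) two_ne_zero).1 this

/-- A continuous function which is positive on the unit interval outside a finite set is
nonnegative there. -/
lemma nonneg_of_pos_off_finite {f : ℝ → ℝ} (hf : Continuous f) {E : Set ℝ} (hE : E.Finite)
    (h : ∀ t, 0 < t → t < 1 → t ∉ E → 0 < f t) {t : ℝ} (ht0 : 0 ≤ t) (ht1 : t ≤ 1) : 0 ≤ f t := by
  by_contra! hneg
  have ho : IsOpen {s | f s < 0} := isOpen_lt hf continuous_const
  have hcl : t ∈ closure (Set.Ioo (0 : ℝ) 1) := by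
    rw [closure_Ioo zero_ne_one]
    exact ⟨ht0, ht1⟩
  obtain ⟨s, hs, hs'⟩ := mem_closure_iff.1 hcl _ ho hneg
  have hinf : ({s | f s < 0} ∩ Set.Ioo (0 : ℝ) 1).Infinite :=
    infinite_of_mem_nhds s ((ho.inter isOpen_Ioo).mem_nhds ⟨hs, hs'⟩)
  obtain ⟨u, hu, huE⟩ := hinf.exists_notMem_finite hE
  exact (h u hu.2.1 hu.2.2 huE).not_gt hu.1

end Trinoid

end

theorem mainTheorem4 {X : Type*} [TopologicalSpace X] (p : X → Trinoid.Base)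
    (hp : Trinoid.IsUniversalCover p)
    (W : Fin 3 → ℝ) (hW : ∀ k, W k < 1 ∧ W k ≠ 0)
    (r : ℝ) (hr : 0 < r ∧ r ≤ 1)
    (Φ : X → ℂ → Matrix (Fin 2) (Fin 2) ℂ)
    (hΦ : Trinoid.SolvesODE p W Φ)
    (hGL : ∀ x : X, ∀ l : ℂ, ‖l‖ = r → IsUnit (Φ x l))
    (x₀ : X) (hhol : ∀ i j : Fin 2, DifferentiableOn ℂ (fun l : ℂ => Φ x₀ l i j) {0}ᶜ)
    (x : X) :
    (Trinoid.NeckInequalities W ∧ Trinoid.WeightInequalities W →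
      Trinoid.PointwiseUnitarizable p Φ x) ∧
    (Trinoid.PointwiseUnitarizable p Φ x →
      Trinoid.NeckInequalities W ∧ Trinoid.WeightInequalities W) := by
  set Z : Set ℂ := {l | ‖l‖ = 1 ∧ (Φ x₀ l).det = 0} with hZ
  have hr0 : (r : ℂ) ≠ 0 := by exact_mod_cast hr.1.ne'
  have hZfin : Z.Finite := by
    refine Trinoid.finite_zeros_on_sphere (f := fun l => (Φ x₀ l).det) ?_ hr0 ?_
    · simp only [det_fin_two]
      exact ((hhol 0 0).mul (hhol 1 1)).sub ((hhol 0 1).mul (hhol 1 0))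
    · exact ((isUnit_iff_isUnit_det _).1 (hGL x₀ r (by simp [abs_of_pos hr.1]))).ne_zero
  have key : ∀ l : ℂ, ‖l‖ = 1 → l ∉ Z →
      ((Trinoid.Nondegenerate (Trinoid.monodromy Φ x l '' Trinoid.deck p) ∧
        Trinoid.SimultaneouslyUnitarizable (Trinoid.monodromy Φ x l '' Trinoid.deck p)) ↔
        0 < Trinoid.spectralDiscr W ((1 - l.re) / 2)) := by
    intro l hl hlZ
    have hl0 : l ≠ 0 := by rintro rfl; simp at hl
    have hre := Trinoid.abs_re_le_of_norm_eq_one hl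
    refine hΦ.unitarizable_iff hp hl0 (fun y => ?_) (Trinoid.sub_one_sq_div_of_norm_eq_one hl)
      (fun k => Trinoid.mul_lt_one_of_mem (by linarith) (by linarith) (hW k).1) x
    rw [hΦ.det_eq hp hl0 y x₀]
    exact fun h => hlZ ⟨hl, h⟩
  constructor
  · rintro ⟨hN, hwt⟩
    refine ⟨Z ∪ {1, -1}, hZfin.union (by simp), fun l hl hlE => ?_⟩
    simp only [Set.mem_union, Set.mem_insert_iff, Set.mem_singleton_iff, not_or] at hlE
    have hre := Trinoid.re_lt_of_norm_eq_one hl hlE.2.1 hlE.2.2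
    exact (key l hl hlE.1).2
      (Trinoid.spectralDiscr_pos hW hN hwt (by linarith) (by linarith))
  · rintro ⟨E, hE, hU⟩
    have hnn : ∀ t, 0 ≤ t → t ≤ 1 → 0 ≤ Trinoid.spectralDiscr W t := fun t h0 h1 =>
      Trinoid.nonneg_of_pos_off_finite (Trinoid.continuous_spectralDiscr W)
        ((hE.union hZfin).image fun l : ℂ => (1 - l.re) / 2) (fun t h0 h1 htE => by
          obtain ⟨l, hl, rfl⟩ := Trinoid.exists_norm_eq_one h0.le h1.le
          have hlE : l ∉ E ∪ Z := fun h => htE ⟨l, h, rfl⟩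
          rw [Set.mem_union, not_or] at hlE
          exact (key l hl hlE.2).1 (hU l hl hlE.1)) h0 h1
    exact ⟨Trinoid.neckInequalities_of_spectralDiscr_nonneg hW hnn,
      Trinoid.weightInequalities_of_spectralDiscr_nonneg hW hnn⟩
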